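/- **Proposition ($d=4$).** *Setting.* Let $\mathcal E=\{\pm e_i\}_{i=1}^4$, let $\mathcal M$ be the set of probability measures on $\mathcal E$, and let $Q$ be a probability measure on $\mathcal M$. An environment is $\omega=(\omega(x,\cdot))_{x\in\mathbb Z^4}\in\mathcal M^{\mathbb Z^4}$, with law $P=Q^{\otimes\mathbb Z^4}$. For $x\in\mathbb Z^4$ let $P^x_\omega$ be the law of the Markov chain $(X(n))_{n\ge0}$ on $\mathbb Z^4$ started at $x$ that jumps from $y$ to $y+e$ with probability $\omega(y,e)$, $e\in\mathcal E$; let $\mathbb P^x=\int P^x_\omega\,dP(\omega)$ be the annealed law and $\mathbb P=\mathbb P^0$, with expectation $\mathbb E$. A time $t\ge 0$ is a regeneration time of $X$ if $\langle X(s),e_1\rangle<\langle X(t),e_1\rangle$ for all $s<t$ and $\langle X(s),e_1\rangle\ge\langle X(t),e_1\rangle$ for all $s>t$; $t^{(1)}<t^{(2)}<\dots$ denote the successive regeneration times. For $U_1,U_2\in\mathbb Z^4$ let $$\mathbf P^D=\mathbb P^{U_1}(\,\cdot\mid D_1)\times\mathbb P^{U_2}(\,\cdot\mid D_2),\qquad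 D_i=\{\langle Y_i(n),e_1\rangle\ge\langle U_i,e_1\rangle\ \text{for all } n\ge0\},$$ be the law of two independent walks $Y_1,Y_2$ in independent environments, with $Y_i(0)=U_i$, each conditioned never to go below its starting level. Let $\|\cdot\|$ be the supremum norm. *Claim.* For every $r>8$ there is $K_4=K_4(r)>0$ such that for every $\kappa>0$ and every $M<\infty$ there is a constant $C=C(r,\kappa,M)>0$ with the following property. Suppose that 1. $Q$ is uniformly elliptic with constant $\kappa$: $Q(\omega(0,e)<\kappa)=0$ for every $e\in\mathcal E$; 2. $X(n)/n\to v$, $\mathbb P$-a.s., for a deterministic $v$ with $\langle v,e_1\rangle>0$; 3. the annealed invariance principle holds with some positive definite covariance matrix $\sigma^2$: under $\mathbb P$, the polygonal interpolations on $[0,1]$ of $k/n\mapsto n^{-1/2}(X(k)-[kv])$ (with $[\cdot]$ the coordinatewise integer part) converge in distribution, in the space of continuous functions with the supremum topology, to a Brownian motion with covariance $\sigma^2$; 4. $\mathbb E[(t^{(1)})^{\varepsilon}]<\infty$ for some $\varepsilon>0$; 5. $\mathbb E[(t^{(2)}-t^{(1)})^r]\le M$. Then for all $U_1\ne U_2$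 in $\mathbb Z^4$, $$\mathbf P^D\big(\{Y_1(n)\}_{n\ge0}\cap\{Y_2(n)\}_{n\ge0}\ne\emptyset\big)<C\,\|U_1-U_2\|^{-K_4}.$$ -/

import Mathlib

open MeasureTheory ProbabilityTheory Filter Topology
open scoped ENNReal NNReal unitInterval

noncomputable section

namespace RWRE

/-! ### Environments and walks -/

/-- The lattice `ℤ^d`. Its norm as a `Pi` type is the supremum norm. -/
abbrev Site (d : ℕ) : Type := Fin d → ℤ

/-- Labels of the `2d` nearest-neighbour steps: `(i, true)` is `e_i`, `(i, false)` is `-e_i`. -/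
abbrev Dir (d : ℕ) : Type := Fin d × Bool

/-- The lattice vector of a step. -/
def Dir.vec {d : ℕ} (e : Dir d) : Site d :=
  if e.2 then Pi.single e.1 1 else -Pi.single e.1 1

/-- The space `M^d` of probability measures on the `2d` steps. -/
abbrev SiteLaw (d : ℕ) : Type := stdSimplex ℝ (Dir d)

/-- The space of environments; `(ω x).1 e` is the probability of the step `e` at `x`. -/
abbrev Env (d : ℕ) : Type := Site d → SiteLaw d

/-- Trajectories in `ℤ^d`. -/
abbrev Traj (d : ℕ) : Type := ℕ → Site d

/-- The i.i.d. law of the environment with marginal `Q`. -/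
def envLaw {d : ℕ} (Q : Measure (SiteLaw d)) : Measure (Env d) :=
  Measure.infinitePi fun _ : Site d => Q

/-- Uniform ellipticity with constant `κ`. -/
def UniformlyElliptic {d : ℕ} (Q : Measure (SiteLaw d)) (κ : ℝ) : Prop :=
  0 < κ ∧ ∀ e : Dir d, Q {p | p.1 e < κ} = 0

/-- The law of the position after one step from `x` in the environment `ω`. -/
def stepLaw {d : ℕ} (ω : Env d) (x : Site d) : Measure (Site d) :=
  ∑ e : Dir d, ENNReal.ofReal ((ω x).1 e) • Measure.dirac (x + e.vec)

instance {d : ℕ} (ω : Env d) (x : Site d) : IsProbabilityMeasure (stepLaw ω x) where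
  measure_univ := by
    simp only [stepLaw, Measure.coe_finsetSum, Finset.sum_apply, Measure.smul_apply,
      measure_univ, smul_eq_mul, mul_one]
    rw [← ENNReal.ofReal_sum_of_nonneg fun e _ => (ω x).2.1 e, (ω x).2.2, ENNReal.ofReal_one]

/-- The transition kernel of the walk in `ω`, which uses only the current position. -/
def stepKernel {d : ℕ} (ω : Env d) (n : ℕ) :
    Kernel (Π _ : Finset.Iic n, Site d) (Site d) :=
  Kernel.ofFunOfCountable fun h => stepLaw ω (h ⟨n, Finset.mem_Iic.2 le_rfl⟩)

instance {d : ℕ} (ω : Env d) (n : ℕ) : IsMarkovKernel (stepKernel ω n) where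
  isProbabilityMeasure h :=
    inferInstanceAs (IsProbabilityMeasure (stepLaw ω (h ⟨n, Finset.mem_Iic.2 le_rfl⟩)))

/-- The quenched law `P_ω^x`: the law of the Markov chain with transitions `stepLaw ω`, started
at `x`. -/
def quenchedLaw {d : ℕ} (x : Site d) (ω : Env d) : Measure (Traj d) :=
  Kernel.traj (X := fun _ => Site d) (stepKernel ω) 0 (fun _ => x)

instance {d : ℕ} (x : Site d) (ω : Env d) : IsProbabilityMeasure (quenchedLaw x ω) :=
  inferInstanceAs (IsProbabilityMeasure
    (Kernel.traj (X := fun _ => Site d) (stepKernel ω) 0 (fun _ => x)))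

theorem measurable_stepLaw {d : ℕ} (x : Site d) :
    Measurable fun ω : Env d => stepLaw ω x := by
  refine Measure.measurable_of_measurable_coe _ fun s _ => ?_
  simp only [stepLaw, Measure.coe_finsetSum, Finset.sum_apply, Measure.smul_apply, smul_eq_mul]
  refine Finset.measurable_sum _ fun e _ => Measurable.mul_const ?_ _
  exact ((measurable_pi_apply e).comp (measurable_subtype_coe.comp (measurable_pi_apply x))).ennreal_ofReal

theorem measurable_partialTraj {d : ℕ} (x : Site d) (n : ℕ) :
    Measurable fun ω : Env d =>
      Kernel.partialTraj (X := fun _ => Site d) (stepKernel ω) 0 n (fun _ => x) := by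
  induction n with
  | zero => simp
  | succ n ih =>
    refine Measure.measurable_of_measurable_coe _ fun s hs => ?_
    simp_rw [Kernel.partialTraj_succ_eq_comp (Nat.zero_le n), Kernel.comp_apply' _ _ _ hs,
      lintegral_countable']
    refine Measurable.tsum fun h => Measurable.mul ?_ ?_
    · have hm : ∀ t : Set (Site d), Measurable fun ω : Env d => stepKernel ω n h t := fun t =>
        (Measure.measurable_coe (MeasurableSet.of_discrete)).comp
          (measurable_stepLaw (h ⟨n, Finset.mem_Iic.2 le_rfl⟩))
      convert! hm (MeasurableEquiv.piSingleton (X := fun _ => Site d) n ⁻¹'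
        (Prod.mk h ⁻¹' (IicProdIoc (X := fun _ => Site d) n (n + 1) ⁻¹' s))) using 2 with ω
      have := Kernel.IsMarkovKernel.map (stepKernel ω n)
        (MeasurableEquiv.piSingleton (X := fun _ => Site d) n).measurable
      have hI : Measurable (IicProdIoc (X := fun _ => Site d) n (n + 1)) := measurable_IicProdIoc
      rw [Kernel.partialTraj_succ_self, Kernel.map_apply' _ hI _ hs,
        Kernel.prod_apply, Kernel.id_apply, Measure.prod_apply (hI hs), lintegral_dirac,
        Kernel.map_apply' _ (MeasurableEquiv.piSingleton (X := fun _ => Site d) n).measurable _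
          (measurable_prodMk_left (hI hs))]
    · exact (Measure.measurable_coe (measurableSet_singleton h)).comp ih

theorem measurable_quenchedLaw {d : ℕ} (x : Site d) :
    Measurable (quenchedLaw (d := d) x) := by
  refine Measurable.measure_of_isPiSystem_of_isProbabilityMeasure
    (S := measurableCylinders fun _ : ℕ => Site d) generateFrom_measurableCylinders.symm
    isPiSystem_measurableCylinders fun t ht => ?_
  obtain ⟨N, S, mS, rfl⟩ : ∃ N S, MeasurableSet S ∧ t = cylinder (Finset.Iic N) S := by
    simpa [measurableCylinders_nat] using ht
  have h : ∀ ω : Env d, quenchedLaw x ω (cylinder (Finset.Iic N) S) =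
      Kernel.partialTraj (X := fun _ => Site d) (stepKernel ω) 0 N (fun _ => x) S := fun ω => by
    rw [← Kernel.traj_map_frestrictLe_apply,
      Measure.map_apply (Preorder.measurable_frestrictLe N) mS]
    rfl
  simp_rw [h]
  exact (Measure.measurable_coe mS).comp (measurable_partialTraj x N)

/-- The annealed law `ℙ^x = ∫ P_ω^x dP(ω)`, a mixture which is well formed by
`measurable_quenchedLaw`. -/
def annealedLaw {d : ℕ} (Q : Measure (SiteLaw d)) (x : Site d) : Measure (Traj d) :=
  (envLaw Q).bind (quenchedLaw x)

instance {d : ℕ} (Q : Measure (SiteLaw d)) [IsProbabilityMeasure Q] :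
    IsProbabilityMeasure (envLaw Q) :=
  inferInstanceAs (IsProbabilityMeasure (Measure.infinitePi fun _ : Site d => Q))

instance {d : ℕ} (Q : Measure (SiteLaw d)) [IsProbabilityMeasure Q] (x : Site d) :
    IsProbabilityMeasure (annealedLaw Q x) where
  measure_univ := by
    rw [annealedLaw, Measure.bind_apply MeasurableSet.univ (measurable_quenchedLaw x).aemeasurable]
    simp

/-! ### Law of large numbers and annealed invariance principle -/

/-- The law of large numbers `X_n / n → v`, almost surely under the annealed law from `0`. -/
def LawOfLargeNumbers {d : ℕ} (Q : Measure (SiteLaw d)) (v : EuclideanSpace ℝ (Fin d)) : Prop :=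
  ∀ᵐ X ∂annealedLaw Q 0, ∀ i : Fin d, Tendsto (fun n : ℕ => (X n i : ℝ) / n) atTop (𝓝 (v i))

/-- The space of continuous paths `[0,1] → ℝ^d` with the topology of uniform convergence. -/
abbrev PathSpace (d : ℕ) : Type := C(I, EuclideanSpace ℝ (Fin d))

instance (d : ℕ) : MeasurableSpace (PathSpace d) := borel _

instance (d : ℕ) : BorelSpace (PathSpace d) := ⟨rfl⟩

/-- The value `B^n(k/n) = (X(k) - [k v]) / √n`, with the integer part taken coordinatewise. -/
def rescaled {d : ℕ} (v : EuclideanSpace ℝ (Fin d)) (n : ℕ) (X : Traj d) (k : ℕ) :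
    EuclideanSpace ℝ (Fin d) :=
  (√(n : ℝ))⁻¹ • WithLp.toLp 2 fun i => (X k i : ℝ) - (⌊(k : ℝ) * v i⌋ : ℝ)

/-- The polygonal interpolation on `[0,1]` of `k/n ↦ B^n(k/n)`. The coefficient of the `k`-th
increment is `0` for `t ≤ k/n`, is `1` for `t ≥ (k+1)/n` and is affine in between. -/
def polygonal {d : ℕ} (v : EuclideanSpace ℝ (Fin d)) (n : ℕ) (X : Traj d) : PathSpace d where
  toFun t := rescaled v n X 0 + ∑ k ∈ Finset.range n,
    max 0 (min 1 ((n : ℝ) * (t : ℝ) - k)) • (rescaled v n X (k + 1) - rescaled v n X k)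
  continuous_toFun := by fun_prop

/-- `W` is the law on path space of a `d`-dimensional Brownian motion with covariance matrix
`S`. -/
structure IsBrownianLaw {d : ℕ} (S : Matrix (Fin d) (Fin d) ℝ) (W : Measure (PathSpace d)) :
    Prop where
  start_zero : ∀ᵐ f ∂W, f 0 = 0
  indep_increments : HasIndepIncrements (fun (t : I) (f : PathSpace d) => f t) W
  gaussian_increments : ∀ s t : I, s ≤ t →
    HasLaw (fun f : PathSpace d => f t - f s)
      (multivariateGaussian 0 (((t : ℝ) - (s : ℝ)) • S)) W

/-- The annealed invariance principle with speed `v` and positive definite covariance matrix `S`: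
under `ℙ`, the interpolated rescaled walks converge in distribution to a Brownian motion with
covariance `S`. -/
def AnnealedInvariancePrinciple {d : ℕ} (Q : Measure (SiteLaw d)) [IsProbabilityMeasure Q]
    (v : EuclideanSpace ℝ (Fin d)) (S : Matrix (Fin d) (Fin d) ℝ) : Prop :=
  S.PosDef ∧ ∃ W : ProbabilityMeasure (PathSpace d), IsBrownianLaw S (W : Measure (PathSpace d)) ∧
    TendstoInDistribution (fun n : ℕ => polygonal v n) atTop (id : PathSpace d → PathSpace d)
      (fun _ => annealedLaw Q 0) (W : Measure (PathSpace d))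

/-! ### Regeneration times and conditioned walks -/

section

variable {d : ℕ} [NeZero d]

/-- `t` is a regeneration time, in direction `e_1` (coordinate `0`), of the trajectory `X`. -/
def IsRegenerationTime (X : Traj d) (t : ℕ) : Prop :=
  (∀ s, s < t → X s 0 < X t 0) ∧ ∀ s, t < s → X t 0 ≤ X s 0

/-- The `k`-th regeneration time `t^{(k)}`, counted from `k = 1`. -/
def regenerationTime (X : Traj d) (k : ℕ) : ℕ :=
  Nat.nth (IsRegenerationTime X) (k - 1)

/-- The moment `𝔼[(t^{(1)})^p]`. -/
def firstRegenerationMoment (Q : Measure (SiteLaw d)) (p : ℝ) : ℝ≥0∞ :=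
  ∫⁻ X, (regenerationTime X 1 : ℝ≥0∞) ^ p ∂annealedLaw Q 0

/-- The moment `𝔼[(t^{(2)} - t^{(1)})^p]`. -/
def regenerationMoment (Q : Measure (SiteLaw d)) (p : ℝ) : ℝ≥0∞ :=
  ∫⁻ X, ((regenerationTime X 2 - regenerationTime X 1 : ℕ) : ℝ≥0∞) ^ p ∂annealedLaw Q 0

/-- The event `D` that the walk never goes below its starting level in direction `e_1`. -/
def noBacktrack (d : ℕ) [NeZero d] : Set (Traj d) := {Y | ∀ n, Y 0 0 ≤ Y n 0}

/-- The law `𝐏^D = ℙ^{U₁}(· | D) × ℙ^{U₂}(· | D)` of a pair of walks in independent environments,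
each conditioned never to go below its starting level. -/
def conditionedPairLaw (Q : Measure (SiteLaw d)) (U₁ U₂ : Site d) : Measure (Traj d × Traj d) :=
  (cond (annealedLaw Q U₁) (noBacktrack d)).prod (cond (annealedLaw Q U₂) (noBacktrack d))

end

/-- The event that two trajectories visit a common site, at possibly different times. -/
def intersect (d : ℕ) : Set (Traj d × Traj d) := {Y | ∃ m n : ℕ, Y.1 m = Y.2 n}

end RWRE

end

/-!
The idea is renewal theory for the conditioned walk, followed by a first moment bound on the number
of close encounters of the two walks.

A trajectory is encoded by the word of its steps. If a word ends strictly above the levels of its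
earlier sites (`Below`), the quenched weight of the word and the quenched probability of never
going below its endpoint depend on the environment in disjoint sets of sites, so the annealed
probability that the walk spells the word and never goes below its endpoint afterwards factorizes
(`annealedLaw_regenEvent`, `wordWeight_append`). Hence the conditioned walk is a concatenation of
independent blocks, whose weights sum to one (`tsum_block`): otherwise the expected number of
regeneration levels would be finite, while transience makes every level a regeneration level with
probability bounded below. The law of large numbers enters only through transience. The length of a
block has the law of `t^{(2)} - t^{(1)}`, so it has a bounded `r`-th moment
(`tsum_block_length_rpow_le`).

If the walks meet, then two blocks meet, and the regeneration points at which these start are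
closer than the sum of the lengths of the blocks (`conditionedPairLaw_intersect_le`). The expected
number of such pairs is expressed by the renewal function `g`, where `g z` is the probability that
the conditioned walk regenerates at `z`. Two facts make it small. First, successive
regeneration points lie on increasing levels, so `g` has mass at most one on each level. Secondly, `g` is
at most of order `ℓ ^ (-9/8)` at height `ℓ`. Indeed, by uniform ellipticity a block has, with
probability bounded below, the displacement `e_1 + ε` for any given vertex `ε` of the cube spanned
by `e_2, e_3, e_4`; after `n` blocks the transversal position contains an independent sum of order
`n` uniform vertices, whose coordinates are independent binomials, so every position has
probability at most of order `n ^ (-3/2)` (`convOp_pow_cubeOp_pow_le`). It takes more than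
`n ≈ ℓ ^ (3/4)` blocks to reach height `ℓ`, unless a block is longer than `ℓ ^ (1/4)`, which the
moment bound makes unlikely (`renewal_le_tail_add`). The same large jump argument shows that `g z`
is tiny when `‖z‖` is much larger than the height, and together
`‖z‖ ^ (1/48) * g z ≤ C * ℓ ^ (-17/16)` (`IsRenewalPair.decay`), which is summable over the levels.
Since two starting points at distance `R` force one of the regeneration points of a close pair to be
at distance of order `R` from its start, or one of the blocks to be that long, the expected number
of close pairs is at most of order `R ^ (-1/48)` (`IsRenewalPair.tsum_pairs_le`).
-/

noncomputable section

namespace RWRE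

/-! ### The quenched Markov property -/

section Quenched

variable {d : ℕ}

/-- The trajectories that agree with `y` up to time `n`. -/
def pathCylinder (n : ℕ) (y : Traj d) : Set (Traj d) := {Y | ∀ i ≤ n, Y i = y i}

theorem measurableSet_pathCylinder (n : ℕ) (y : Traj d) : MeasurableSet (pathCylinder n y) := by
  have : pathCylinder n y = ⋂ i, ⋂ (_ : i ≤ n), {Y : Traj d | Y i = y i} := by
    ext; simp [pathCylinder]
  rw [this]
  exact MeasurableSet.iInter fun i => MeasurableSet.iInter fun _ =>
    measurableSet_eq_fun (measurable_pi_apply i) measurable_const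

theorem pathCylinder_eq_preimage (n : ℕ) (y : Traj d) :
    pathCylinder n y = Preorder.frestrictLe (π := fun _ => Site d) n ⁻¹'
      {Preorder.frestrictLe (π := fun _ => Site d) n y} := by
  ext Y
  simp [pathCylinder, funext_iff]

/-- A finite measure on trajectories is determined by the probabilities of finite paths. -/
theorem ext_of_pathCylinder {μ ν : Measure (Traj d)} [IsFiniteMeasure μ]
    (h : ∀ n y, μ (pathCylinder n y) = ν (pathCylinder n y)) : μ = ν := by
  have key : ∀ N, μ.map (Preorder.frestrictLe (π := fun _ => Site d) N) =
      ν.map (Preorder.frestrictLe (π := fun _ => Site d) N) := fun N => by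
    refine Measure.ext_of_singleton fun s => ?_
    obtain ⟨y, rfl⟩ : ∃ y : Traj d, Preorder.frestrictLe (π := fun _ => Site d) N y = s :=
      ⟨fun i => if hi : i ≤ N then s ⟨i, Finset.mem_Iic.2 hi⟩ else 0, by
        ext1 ⟨i, hi⟩; simp [Finset.mem_Iic.1 hi]⟩
    rw [Measure.map_apply (Preorder.measurable_frestrictLe N) (measurableSet_singleton _),
      Measure.map_apply (Preorder.measurable_frestrictLe N) (measurableSet_singleton _),
      ← pathCylinder_eq_preimage, h]
  have cyl : ∀ t ∈ measurableCylinders fun _ : ℕ => Site d, μ t = ν t := fun t ht => by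
    obtain ⟨N, S, mS, rfl⟩ : ∃ N S, MeasurableSet S ∧ t = cylinder (Finset.Iic N) S := by
      simpa [measurableCylinders_nat] using ht
    have h2 := congrArg (fun m => m S) (key N)
    have hm := Preorder.measurable_frestrictLe (X := fun _ : ℕ => Site d) N
    rwa [Measure.map_apply hm mS, Measure.map_apply hm mS] at h2
  refine ext_of_generate_finite (measurableCylinders fun _ : ℕ => Site d)
    generateFrom_measurableCylinders.symm isPiSystem_measurableCylinders cyl ?_
  exact cyl _ (univ_mem_measurableCylinders _)

theorem partialTraj_succ_singleton (ω : Env d) (n : ℕ) (h : Π _ : Finset.Iic n, Site d)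
    (y : Traj d) :
    Kernel.partialTraj (X := fun _ => Site d) (stepKernel ω) n (n + 1) h
      {Preorder.frestrictLe (π := fun _ => Site d) (n + 1) y} =
    if h = Preorder.frestrictLe (π := fun _ => Site d) n y then
      stepLaw ω (y n) {y (n + 1)} else 0 := by
  have := Kernel.IsMarkovKernel.map (stepKernel ω n)
    (MeasurableEquiv.piSingleton (X := fun _ => Site d) n).measurable
  have hI : Measurable (IicProdIoc (X := fun _ => Site d) n (n + 1)) := measurable_IicProdIoc
  have hs : MeasurableSet {Preorder.frestrictLe (π := fun _ => Site d) (n + 1) y} :=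
    measurableSet_singleton _
  rw [Kernel.partialTraj_succ_self, Kernel.map_apply' _ hI _ hs,
    Kernel.prod_apply, Kernel.id_apply, Measure.prod_apply (hI hs), lintegral_dirac,
    Kernel.map_apply' _ (MeasurableEquiv.piSingleton (X := fun _ => Site d) n).measurable _
      (measurable_prodMk_left (hI hs))]
  split_ifs with hy
  · subst hy
    change stepLaw ω (y n) _ = _
    congr 1
    ext z
    simp only [Set.mem_preimage, Set.mem_singleton_iff, funext_iff, Subtype.forall,
      Finset.mem_Iic, Preorder.frestrictLe_apply]
    constructor
    · intro hz
      simpa [_root_.IicProdIoc, MeasurableEquiv.piSingleton] using hz (n + 1) le_rfl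
    · intro hz i hi
      rcases Nat.lt_or_ge n i with h1 | h1
      · obtain rfl : i = n + 1 := by omega
        simpa [_root_.IicProdIoc, MeasurableEquiv.piSingleton] using hz
      · simp [_root_.IicProdIoc, h1]
  · convert measure_empty (μ := stepKernel ω n h)
    rw [Set.eq_empty_iff_forall_notMem]
    intro z hz
    apply hy
    simp only [Set.mem_preimage, Set.mem_singleton_iff, funext_iff, Subtype.forall,
      Finset.mem_Iic, Preorder.frestrictLe_apply] at hz
    ext1 ⟨i, hi⟩
    have := hz i (le_trans (Finset.mem_Iic.1 hi) n.le_succ)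
    simp only [_root_.IicProdIoc, Finset.mem_Iic.1 hi, dite_true] at this
    exact funext this

theorem quenchedLaw_pathCylinder_eq_partialTraj (x : Site d) (ω : Env d) (n : ℕ) (y : Traj d) :
    quenchedLaw x ω (pathCylinder n y) =
      Kernel.partialTraj (X := fun _ => Site d) (stepKernel ω) 0 n (fun _ => x)
        {Preorder.frestrictLe (π := fun _ => Site d) n y} := by
  rw [← Kernel.traj_map_frestrictLe_apply,
    Measure.map_apply (Preorder.measurable_frestrictLe n) (measurableSet_singleton _),
    ← pathCylinder_eq_preimage]
  rfl

theorem quenchedLaw_pathCylinder_succ (x : Site d) (ω : Env d) (n : ℕ) (y : Traj d) :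
    quenchedLaw x ω (pathCylinder (n + 1) y) =
      quenchedLaw x ω (pathCylinder n y) * stepLaw ω (y n) {y (n + 1)} := by
  rw [quenchedLaw_pathCylinder_eq_partialTraj, quenchedLaw_pathCylinder_eq_partialTraj,
    Kernel.partialTraj_succ_eq_comp (Nat.zero_le n),
    Kernel.comp_apply' _ _ _ (measurableSet_singleton _)]
  simp_rw [partialTraj_succ_singleton]
  rw [mul_comm, ← lintegral_indicator_const (measurableSet_singleton _)]
  refine lintegral_congr fun b => ?_
  simp [Set.indicator_apply]

theorem quenchedLaw_pathCylinder_zero (x : Site d) (ω : Env d) (y : Traj d) :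
    quenchedLaw x ω (pathCylinder 0 y) = if y 0 = x then 1 else 0 := by
  rw [quenchedLaw_pathCylinder_eq_partialTraj]
  rw [Kernel.partialTraj_self, Kernel.id_apply, Measure.dirac_apply' _ (measurableSet_singleton _)]
  rw [Set.indicator_apply]
  congr 1
  rw [Set.mem_singleton_iff, eq_iff_iff, funext_iff]
  constructor
  · intro h; exact (h ⟨0, by simp⟩).symm
  · rintro h ⟨i, hi⟩
    obtain rfl : i = 0 := by simpa using hi
    exact h.symm

/-- The quenched probability of a finite path is the product of the step probabilities. -/
theorem quenchedLaw_pathCylinder (x : Site d) (ω : Env d) (n : ℕ) (y : Traj d) :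
    quenchedLaw x ω (pathCylinder n y) =
      (if y 0 = x then 1 else 0) * ∏ i ∈ Finset.range n, stepLaw ω (y i) {y (i + 1)} := by
  induction n with
  | zero => simp [quenchedLaw_pathCylinder_zero]
  | succ n ih => rw [quenchedLaw_pathCylinder_succ, ih, Finset.prod_range_succ, mul_assoc]

/-- The trajectory seen from time `n` on. -/
def shift (n : ℕ) (Y : Traj d) : Traj d := fun k => Y (n + k)

theorem measurable_shift (n : ℕ) : Measurable (shift (d := d) n) :=
  measurable_pi_lambda _ fun k => measurable_pi_apply (n + k)

theorem shift_shift (m n : ℕ) (Y : Traj d) : shift m (shift n Y) = shift (n + m) Y := by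
  ext k : 1; simp [shift, add_assoc]

/-- The trajectory that starts at `x` and then follows `Y`. -/
def consTraj (x : Site d) (Y : Traj d) : Traj d := fun n => Nat.casesOn n x fun k => Y k

theorem measurable_consTraj (x : Site d) : Measurable (consTraj x) := by
  refine measurable_pi_lambda _ fun k => ?_
  cases k with
  | zero => exact measurable_const
  | succ k => exact measurable_pi_apply k

theorem quenchedLaw_start (x : Site d) (ω : Env d) :
    quenchedLaw x ω {Y | Y 0 = x}ᶜ = 0 := by
  have h : MeasurableSet {Y : Traj d | Y 0 = x} :=
    measurableSet_eq_fun (measurable_pi_apply 0) measurable_const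
  rw [prob_compl_eq_zero_iff h]
  have := quenchedLaw_pathCylinder_zero x ω fun _ => x
  simpa [pathCylinder] using this

theorem Dir.vec_injective : Function.Injective (Dir.vec (d := d)) := by
  rintro ⟨i, a⟩ ⟨j, b⟩ h
  have h1 := congrFun h i
  by_cases hij : i = j
  · subst hij
    cases a <;> cases b <;> simp [Dir.vec] at h1 ⊢
  · cases a <;> cases b <;> simp [Dir.vec, hij] at h1

/-- The Markov property at time `1`. -/
theorem quenchedLaw_eq_sum (x : Site d) (ω : Env d) :
    quenchedLaw x ω =
      ∑ e : Dir d, ENNReal.ofReal ((ω x).1 e) •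
        (quenchedLaw (x + e.vec) ω).map (consTraj x) := by
  refine ext_of_pathCylinder fun n y => ?_
  simp only [Measure.coe_finsetSum, Finset.sum_apply, Measure.smul_apply, smul_eq_mul]
  simp_rw [Measure.map_apply (measurable_consTraj x) (measurableSet_pathCylinder n y)]
  cases n with
  | zero =>
    rw [quenchedLaw_pathCylinder_zero]
    have : consTraj x ⁻¹' pathCylinder 0 y = if y 0 = x then Set.univ else ∅ := by
      ext Y
      split_ifs with h <;> simp [pathCylinder, consTraj, h, eq_comm (a := x)]
    rw [this]
    split_ifs with h
    · simp only [measure_univ, mul_one]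
      rw [← ENNReal.ofReal_sum_of_nonneg fun e _ => (ω x).2.1 e, (ω x).2.2, ENNReal.ofReal_one]
    · simp
  | succ n =>
    have : consTraj x ⁻¹' pathCylinder (n + 1) y =
        if y 0 = x then pathCylinder n (shift 1 y) else ∅ := by
      ext Y
      split_ifs with h
      · simp only [Set.mem_preimage, pathCylinder, Set.mem_ofPred_eq, shift]
        constructor
        · intro hY i hi
          simpa [consTraj, add_comm] using hY (i + 1) (by omega)
        · rintro hY (_ | i) hi
          · simp [consTraj, h]
          · simpa [consTraj, add_comm] using hY i (by omega)
      · simp only [Set.mem_preimage, pathCylinder, Set.mem_ofPred_eq, Set.mem_empty_iff_false,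
          iff_false]
        intro hY
        exact h (hY 0 (by omega)).symm
    rw [this]
    split_ifs with h
    · rw [quenchedLaw_pathCylinder, if_pos h, one_mul, Finset.prod_range_succ', h]
      simp_rw [quenchedLaw_pathCylinder]
      have : stepLaw ω x {y (0 + 1)} =
          ∑ e : Dir d, ENNReal.ofReal ((ω x).1 e) * if shift 1 y 0 = x + e.vec then 1 else 0 := by
        simp only [stepLaw, Measure.coe_finsetSum, Finset.sum_apply, Measure.smul_apply,
          smul_eq_mul]
        refine Finset.sum_congr rfl fun e _ => ?_
        rw [Measure.dirac_apply' _ (measurableSet_singleton _), Set.indicator_apply]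
        simp [shift, eq_comm]
      rw [this, mul_comm, Finset.sum_mul]
      refine Finset.sum_congr rfl fun e _ => ?_
      rw [mul_assoc]
      simp [shift, add_comm]
    · rw [quenchedLaw_pathCylinder, if_neg h]
      simp

end Quenched

/-! ### Words and their quenched and annealed weights -/

section Words

variable {d : ℕ}

/-- The displacement of a word of steps. -/
def disp (l : List (Dir d)) : Site d := (l.map Dir.vec).sum

@[simp] theorem disp_nil : disp ([] : List (Dir d)) = 0 := rfl

@[simp] theorem disp_cons (e : Dir d) (l : List (Dir d)) : disp (e :: l) = e.vec + disp l := by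
  simp [disp]

@[simp] theorem disp_append (l₁ l₂ : List (Dir d)) : disp (l₁ ++ l₂) = disp l₁ + disp l₂ := by
  simp [disp]

/-- The trajectories that start at `x` and whose first steps spell the word `l`. -/
def follows (x : Site d) (l : List (Dir d)) : Set (Traj d) :=
  {Y | ∀ i ≤ l.length, Y i = x + disp (l.take i)}

theorem measurableSet_follows (x : Site d) (l : List (Dir d)) : MeasurableSet (follows x l) :=
  measurableSet_pathCylinder l.length fun i => x + disp (l.take i)

theorem follows_start {x : Site d} {l : List (Dir d)} {Y : Traj d} (h : Y ∈ follows x l) :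
    Y 0 = x := by
  simpa using h 0 (Nat.zero_le _)

theorem follows_end {x : Site d} {l : List (Dir d)} {Y : Traj d} (h : Y ∈ follows x l) :
    Y l.length = x + disp l := by
  simpa using h l.length le_rfl

theorem follows_append {x : Site d} {l₁ l₂ : List (Dir d)} {Y : Traj d} :
    Y ∈ follows x (l₁ ++ l₂) ↔
      Y ∈ follows x l₁ ∧ shift l₁.length Y ∈ follows (x + disp l₁) l₂ := by
  constructor
  · intro h
    refine ⟨fun i hi => ?_, fun i hi => ?_⟩
    · rw [h i (by simp; omega), List.take_append_of_le_length hi]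
    · rw [shift, h _ (by simp; omega), List.take_length_add_append, disp_append, add_assoc]
  · rintro ⟨h1, h2⟩ i hi
    rcases le_total i l₁.length with h | h
    · rw [h1 i h, List.take_append_of_le_length h]
    · obtain ⟨j, rfl⟩ := Nat.exists_eq_add_of_le h
      rw [List.take_length_add_append, disp_append, ← add_assoc]
      exact h2 j (by simpa using hi)

/-- Two words of the same length that are followed by the same trajectory are equal. -/
theorem follows_inj {x : Site d} {l₁ l₂ : List (Dir d)} {Y : Traj d} (h₁ : Y ∈ follows x l₁)
    (h₂ : Y ∈ follows x l₂) (hl : l₁.length = l₂.length) : l₁ = l₂ := by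
  induction l₁ generalizing x l₂ Y with
  | nil => simpa [eq_comm] using hl
  | cons e l ih =>
    cases l₂ with
    | nil => simp at hl
    | cons e' l' =>
      have h₁' := (follows_append (l₁ := [e]) (l₂ := l)).1 h₁
      have h₂' := (follows_append (l₁ := [e']) (l₂ := l')).1 h₂
      have he : e = e' := by
        have a := h₁ 1 (by simp)
        have b := h₂ 1 (by simp)
        apply Dir.vec_injective
        simpa [a] using b
      subst he
      rw [ih h₁'.2 h₂'.2 (by simpa using hl)]

/-- The quenched probability that the first steps of the walk started at `x` spell `l`. -/
def pathWeight (ω : Env d) : Site d → List (Dir d) → ℝ≥0∞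
  | _, [] => 1
  | x, e :: l => ENNReal.ofReal ((ω x).1 e) * pathWeight ω (x + e.vec) l

theorem pathWeight_append (ω : Env d) (x : Site d) (l₁ l₂ : List (Dir d)) :
    pathWeight ω x (l₁ ++ l₂) = pathWeight ω x l₁ * pathWeight ω (x + disp l₁) l₂ := by
  induction l₁ generalizing x with
  | nil => simp [pathWeight]
  | cons e l ih => simp [pathWeight, ih, mul_assoc, add_assoc]

/-- The Markov property along a word. -/
theorem quenchedLaw_follows_inter (ω : Env d) (x : Site d) (l : List (Dir d))
    {A : Set (Traj d)} (hA : MeasurableSet A) :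
    quenchedLaw x ω (follows x l ∩ shift l.length ⁻¹' A) =
      pathWeight ω x l * quenchedLaw (x + disp l) ω A := by
  induction l generalizing x with
  | nil =>
    have h0 : shift (d := d) 0 = id := by funext Y k; simp [shift]
    have h1 : follows x [] = {Y : Traj d | Y 0 = x} := by ext; simp [follows]
    simp only [List.length_nil, h0, Set.preimage_id, h1, pathWeight, one_mul, disp_nil, add_zero]
    rw [Set.inter_comm]
    exact measure_inter_conull (quenchedLaw_start x ω)
  | cons e l ih =>
    have hpre : consTraj x ⁻¹' (follows x (e :: l) ∩ shift (e :: l).length ⁻¹' A) =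
        follows (x + e.vec) l ∩ shift l.length ⁻¹' A := by
      ext Y
      have h1 : consTraj x Y ∈ follows x (e :: l) ↔ Y ∈ follows (x + e.vec) l := by
        constructor
        · intro h i hi
          simpa [consTraj, add_assoc] using h (i + 1) (by simpa using hi)
        · rintro h (_ | i) hi
          · simp [consTraj]
          · simpa [consTraj, add_assoc] using h i (by simpa using hi)
      have h2 : shift (e :: l).length (consTraj x Y) = shift l.length Y := by
        funext k
        have : (e :: l).length + k = (l.length + k) + 1 := by simp; omega
        simp only [shift, this]
        rfl
      simp only [Set.mem_preimage, Set.mem_inter_iff, h1, h2]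
    have hms : MeasurableSet (follows x (e :: l) ∩ shift (e :: l).length ⁻¹' A) :=
      (measurableSet_follows _ _).inter (measurable_shift _ hA)
    rw [quenchedLaw_eq_sum]
    simp only [Measure.coe_finsetSum, Finset.sum_apply, Measure.smul_apply, smul_eq_mul]
    simp_rw [Measure.map_apply (measurable_consTraj x) hms, hpre]
    rw [Finset.sum_eq_single e]
    · rw [ih, pathWeight, disp_cons, mul_assoc, add_assoc]
    · intro e' _ he
      convert mul_zero _
      refine measure_mono_null (fun Y hY => ?_) (quenchedLaw_start (x + e'.vec) ω)
      have h := follows_start hY.1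
      simp only [Set.mem_compl_iff, Set.mem_ofPred_eq, h, add_right_inj]
      exact fun h => he (Dir.vec_injective h).symm
    · simp

theorem quenchedLaw_follows (ω : Env d) (x : Site d) (l : List (Dir d)) :
    quenchedLaw x ω (follows x l) = pathWeight ω x l := by
  simpa using quenchedLaw_follows_inter ω x l MeasurableSet.univ

theorem measurable_quenchedLaw_apply (x : Site d) {A : Set (Traj d)} (hA : MeasurableSet A) :
    Measurable fun ω => quenchedLaw x ω A :=
  (Measure.measurable_coe hA).comp (measurable_quenchedLaw x)

/-- The `σ`-algebra generated by the environment on a set of sites. -/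
@[reducible] def envSigma (S : Set (Site d)) : MeasurableSpace (Env d) :=
  ⨆ x ∈ S, MeasurableSpace.comap (fun ω : Env d => ω x) inferInstance

theorem measurable_siteProb {S : Set (Site d)} {x : Site d} (hx : x ∈ S) (e : Dir d) :
    Measurable[envSigma S] fun ω : Env d => ENNReal.ofReal ((ω x).1 e) := by
  have h1 : Measurable[envSigma S] fun ω : Env d => ω x :=
    Measurable.of_comap_le (le_iSup₂_of_le x hx le_rfl)
  exact ((measurable_pi_apply e).comp (measurable_subtype_coe.comp h1)).ennreal_ofReal

theorem measurable_pathWeight {S : Set (Site d)} {x : Site d} {l : List (Dir d)}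
    (h : ∀ i < l.length, x + disp (l.take i) ∈ S) :
    Measurable[envSigma S] fun ω : Env d => pathWeight ω x l := by
  induction l generalizing x with
  | nil => exact measurable_const
  | cons e l ih =>
    refine Measurable.mul (measurable_siteProb (by simpa using h 0 (by simp)) e) (ih ?_)
    intro i hi
    simpa [add_assoc] using h (i + 1) (by simpa using hi)

theorem envSigma_le (S : Set (Site d)) : envSigma S ≤ (inferInstance : MeasurableSpace (Env d)) :=
  iSup₂_le fun x _ => (measurable_pi_apply x).comap_le

/-- Functions of the environment on disjoint sets of sites are independent. -/
theorem lintegral_envLaw_mul (Q : Measure (SiteLaw d)) [IsProbabilityMeasure Q]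
    {S T : Set (Site d)} (hST : Disjoint S T) {f g : Env d → ℝ≥0∞}
    (hf : Measurable[envSigma S] f) (hg : Measurable[envSigma T] g) :
    ∫⁻ ω, f ω * g ω ∂envLaw Q = (∫⁻ ω, f ω ∂envLaw Q) * ∫⁻ ω, g ω ∂envLaw Q := by
  have hind : iIndepFun (fun (x : Site d) (ω : Env d) => ω x) (envLaw Q) :=
    iIndepFun_infinitePi (X := fun _ ω => ω) fun _ => measurable_id
  exact lintegral_mul_eq_lintegral_mul_lintegral_of_independent_measurableSpace
    (envSigma_le S) (envSigma_le T)
    (indep_iSup_of_disjoint (fun x => (measurable_pi_apply x).comap_le) hind hST) hf hg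

/-- The environment seen from the site `a`. -/
def translateEnv (a : Site d) (ω : Env d) : Env d := fun x => ω (x + a)

theorem measurePreserving_translateEnv (Q : Measure (SiteLaw d)) [IsProbabilityMeasure Q]
    (a : Site d) : MeasurePreserving (translateEnv a) (envLaw Q) (envLaw Q) where
  measurable := measurable_pi_lambda _ fun x => measurable_pi_apply (x + a)
  map_eq := Measure.map_infinitePi_infinitePi_of_inj (P := fun _ : Site d => Q)
    (add_left_injective a)

theorem pathWeight_translateEnv (a : Site d) (ω : Env d) (x : Site d) (l : List (Dir d)) :
    pathWeight (translateEnv a ω) x l = pathWeight ω (x + a) l := by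
  induction l generalizing x with
  | nil => rfl
  | cons e l ih => simp only [pathWeight, ih, translateEnv, add_right_comm]

theorem measurable_pathWeight' (x : Site d) (l : List (Dir d)) :
    Measurable fun ω : Env d => pathWeight ω x l :=
  (measurable_pathWeight (S := Set.univ) (by simp)).mono (envSigma_le _) le_rfl

/-- The annealed probability that the first steps of the walk spell `l`. -/
def wordWeight (Q : Measure (SiteLaw d)) (l : List (Dir d)) : ℝ≥0∞ :=
  ∫⁻ ω, pathWeight ω 0 l ∂envLaw Q

theorem lintegral_pathWeight (Q : Measure (SiteLaw d)) [IsProbabilityMeasure Q] (x : Site d)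
    (l : List (Dir d)) : ∫⁻ ω, pathWeight ω x l ∂envLaw Q = wordWeight Q l := by
  rw [wordWeight, ← (measurePreserving_translateEnv Q x).lintegral_comp
    (measurable_pathWeight' 0 l)]
  simp [pathWeight_translateEnv]

theorem annealedLaw_apply (Q : Measure (SiteLaw d)) (x : Site d) {A : Set (Traj d)}
    (hA : MeasurableSet A) : annealedLaw Q x A = ∫⁻ ω, quenchedLaw x ω A ∂envLaw Q :=
  Measure.bind_apply hA (measurable_quenchedLaw x).aemeasurable

theorem annealedLaw_follows (Q : Measure (SiteLaw d)) [IsProbabilityMeasure Q] (x : Site d)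
    (l : List (Dir d)) : annealedLaw Q x (follows x l) = wordWeight Q l := by
  rw [annealedLaw_apply Q x (measurableSet_follows x l)]
  simp_rw [quenchedLaw_follows]
  exact lintegral_pathWeight Q x l

theorem wordWeight_nil (Q : Measure (SiteLaw d)) [IsProbabilityMeasure Q] :
    wordWeight Q [] = 1 := by
  simp [wordWeight, pathWeight]

/-- An event that is null for every starting point is null after every time shift. -/
theorem annealedLaw_shift_null (Q : Measure (SiteLaw d)) {A : Set (Traj d)} (hA : MeasurableSet A)
    (h : ∀ x, annealedLaw Q x A = 0) (x : Site d) (n : ℕ) :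
    annealedLaw Q x (shift n ⁻¹' A) = 0 := by
  have hae : ∀ᵐ ω ∂envLaw Q, ∀ z, quenchedLaw z ω A = 0 := by
    rw [ae_all_iff]
    intro z
    have := h z
    rw [annealedLaw_apply Q z hA, lintegral_eq_zero_iff (measurable_quenchedLaw_apply z hA)] at this
    exact this
  rw [annealedLaw_apply Q x (measurable_shift n hA),
    lintegral_eq_zero_iff (measurable_quenchedLaw_apply x (measurable_shift n hA))]
  filter_upwards [hae] with ω hω
  have key : ∀ n z, quenchedLaw z ω (shift n ⁻¹' A) = 0 := by
    intro n
    induction n with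
    | zero =>
      intro z
      have h0 : shift (d := d) 0 = id := by funext Y k; simp [shift]
      simpa [h0] using hω z
    | succ n ih =>
      intro z
      rw [quenchedLaw_eq_sum]
      simp only [Measure.coe_finsetSum, Finset.sum_apply, Measure.smul_apply, smul_eq_mul]
      refine Finset.sum_eq_zero fun e _ => ?_
      rw [Measure.map_apply (measurable_consTraj z) (measurable_shift _ hA)]
      convert mul_zero _
      convert ih (z + e.vec) using 2
      ext Y
      simp only [Set.mem_preimage]
      have : shift (n + 1) (consTraj z Y) = shift n Y := by
        funext k
        have : n + 1 + k = (n + k) + 1 := by omega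
        simp only [shift, this]
        rfl
      rw [this]
  exact key n x

theorem annealedLaw_start (Q : Measure (SiteLaw d)) (x : Site d) :
    ∀ᵐ Y ∂annealedLaw Q x, Y 0 = x := by
  have hm : MeasurableSet {Y : Traj d | Y 0 = x}ᶜ :=
    (measurableSet_eq_fun (measurable_pi_apply 0) measurable_const).compl
  have : annealedLaw Q x {Y | Y 0 = x}ᶜ = 0 := by
    rw [annealedLaw_apply Q x hm]
    simp [quenchedLaw_start]
  exact this

/-- The walk makes nearest-neighbour steps. -/
theorem annealedLaw_steps (Q : Measure (SiteLaw d)) (x : Site d) :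
    ∀ᵐ Y ∂annealedLaw Q x, ∀ n, ∃ e : Dir d, Y (n + 1) = Y n + e.vec := by
  set A : Set (Traj d) := {Y | ∃ e : Dir d, Y 1 = Y 0 + e.vec}ᶜ with hAdef
  have hA : MeasurableSet A := by
    refine MeasurableSet.compl ?_
    have : {Y : Traj d | ∃ e : Dir d, Y 1 = Y 0 + e.vec} =
        ⋃ e : Dir d, {Y : Traj d | Y 1 = Y 0 + e.vec} := by ext; simp
    rw [this]
    exact MeasurableSet.iUnion fun e => measurableSet_eq_fun (measurable_pi_apply 1)
      ((measurable_pi_apply 0).add_const _)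
  have h0 : ∀ x, annealedLaw Q x A = 0 := by
    intro x
    rw [annealedLaw_apply Q x hA]
    refine (lintegral_congr fun ω => ?_).trans lintegral_zero
    rw [quenchedLaw_eq_sum]
    simp only [Measure.coe_finsetSum, Finset.sum_apply, Measure.smul_apply, smul_eq_mul]
    refine Finset.sum_eq_zero fun e _ => ?_
    rw [Measure.map_apply (measurable_consTraj x) hA]
    convert mul_zero _
    refine measure_mono_null (fun Y hY => ?_) (quenchedLaw_start (x + e.vec) ω)
    intro h
    exact hY ⟨e, h⟩
  rw [ae_all_iff]
  intro n
  have := annealedLaw_shift_null Q hA h0 x n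
  filter_upwards [compl_mem_ae_iff.2 this] with Y hY
  simpa [hAdef, shift] using hY

end Words

/-! ### Independence across levels -/

section Levels

variable {d : ℕ} [NeZero d]

/-- The word `l` ends strictly above the levels of all its earlier sites. -/
def Below (l : List (Dir d)) : Prop := ∀ i < l.length, disp (l.take i) 0 < disp l 0

/-- The word `l` never goes below its starting level. -/
def Above (l : List (Dir d)) : Prop := ∀ i ≤ l.length, 0 ≤ disp (l.take i) 0

theorem measurableSet_noBacktrack : MeasurableSet (noBacktrack d) := by
  have : noBacktrack d = ⋂ n, {Y : Traj d | Y 0 0 ≤ Y n 0} := by ext; simp [noBacktrack]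
  rw [this]
  refine MeasurableSet.iInter fun n => measurableSet_le ?_ ?_
  · exact (measurable_pi_apply 0).comp (measurable_pi_apply 0)
  · exact (measurable_pi_apply 0).comp (measurable_pi_apply n)

/-- The trajectories that stay at levels at least `L` up to time `N`. -/
def stayAbove (d : ℕ) [NeZero d] (L : ℤ) (N : ℕ) : Set (Traj d) := {Y | ∀ i ≤ N, L ≤ Y i 0}

theorem measurableSet_stayAbove (L : ℤ) (N : ℕ) : MeasurableSet (stayAbove d L N) := by
  have : stayAbove d L N = ⋂ n, ⋂ (_ : n ≤ N), {Y : Traj d | L ≤ Y n 0} := by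
    ext; simp [stayAbove]
  rw [this]
  refine MeasurableSet.iInter fun n => MeasurableSet.iInter fun _ =>
    measurableSet_le measurable_const ?_
  exact (measurable_pi_apply 0).comp (measurable_pi_apply n)

theorem quenchedLaw_stayAbove_zero (ω : Env d) (x : Site d) (L : ℤ) :
    quenchedLaw x ω (stayAbove d L 0) = if L ≤ x 0 then 1 else 0 := by
  have h : ∀ᵐ Y ∂quenchedLaw x ω, Y 0 = x := quenchedLaw_start x ω
  split_ifs with hL
  · rw [← prob_compl_eq_zero_iff (measurableSet_stayAbove L 0)]
    change ∀ᵐ Y ∂quenchedLaw x ω, Y ∈ stayAbove d L 0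
    filter_upwards [h] with Y hY
    simpa [stayAbove, hY] using hL
  · rw [measure_eq_zero_iff_ae_notMem]
    filter_upwards [h] with Y hY
    simpa [stayAbove, hY] using hL

theorem quenchedLaw_stayAbove_succ (ω : Env d) (x : Site d) (L : ℤ) (N : ℕ) :
    quenchedLaw x ω (stayAbove d L (N + 1)) = if L ≤ x 0 then
      ∑ e : Dir d, ENNReal.ofReal ((ω x).1 e) * quenchedLaw (x + e.vec) ω (stayAbove d L N)
      else 0 := by
  rw [quenchedLaw_eq_sum]
  simp only [Measure.coe_finsetSum, Finset.sum_apply, Measure.smul_apply, smul_eq_mul]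
  simp_rw [Measure.map_apply (measurable_consTraj x) (measurableSet_stayAbove L (N + 1))]
  have : consTraj x ⁻¹' stayAbove d L (N + 1) = if L ≤ x 0 then stayAbove d L N else ∅ := by
    ext Y
    split_ifs with h
    · constructor
      · intro hY i hi
        exact hY (i + 1) (by omega)
      · rintro hY (_ | i) hi
        · exact h
        · exact hY i (by omega)
    · simp only [Set.mem_empty_iff_false, iff_false]
      intro hY
      exact h (hY 0 (by omega))
  rw [this]
  split_ifs <;> simp

/-- The walk killed below level `L` does not see the environment below `L`. -/
theorem measurable_quenchedLaw_stayAbove (x : Site d) (L : ℤ) (N : ℕ) :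
    Measurable[envSigma {z : Site d | L ≤ z 0}]
      fun ω => quenchedLaw x ω (stayAbove d L N) := by
  induction N generalizing x with
  | zero => simp_rw [quenchedLaw_stayAbove_zero]; exact measurable_const
  | succ N ih =>
    simp_rw [quenchedLaw_stayAbove_succ]
    split_ifs with h
    · exact Finset.measurable_fun_sum _ fun e _ => (measurable_siteProb h e).mul (ih _)
    · exact measurable_const

theorem quenchedLaw_stayAbove_translateEnv (a : Site d) (ω : Env d) (x : Site d) (L : ℤ) (N : ℕ) :
    quenchedLaw x (translateEnv a ω) (stayAbove d L N) =
      quenchedLaw (x + a) ω (stayAbove d (L + a 0) N) := by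
  induction N generalizing x with
  | zero => simp [quenchedLaw_stayAbove_zero]
  | succ N ih => simp [quenchedLaw_stayAbove_succ, ih, translateEnv, add_right_comm]

theorem quenchedLaw_noBacktrack (ω : Env d) (x : Site d) :
    quenchedLaw x ω (noBacktrack d) = ⨅ N, quenchedLaw x ω (stayAbove d (x 0) N) := by
  have h : ∀ᵐ Y ∂quenchedLaw x ω, Y 0 = x := quenchedLaw_start x ω
  have h1 : quenchedLaw x ω (noBacktrack d) = quenchedLaw x ω (⋂ N, stayAbove d (x 0) N) := by
    refine measure_congr ?_
    filter_upwards [h] with Y hY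
    refine propext ?_
    change (∀ n, Y 0 0 ≤ Y n 0) ↔ Y ∈ ⋂ N, stayAbove d (x 0) N
    simp only [Set.mem_iInter, hY]
    exact ⟨fun h N i _ => h i, fun h n => h n n le_rfl⟩
  rw [h1]
  refine Antitone.measure_iInter ?_ (fun N => (measurableSet_stayAbove _ N).nullMeasurableSet)
    ⟨0, measure_ne_top _ _⟩
  intro M N hMN Y hY i hi
  exact hY i (hi.trans hMN)

theorem measurable_quenchedLaw_noBacktrack (x : Site d) :
    Measurable[envSigma {z : Site d | x 0 ≤ z 0}]
      fun ω => quenchedLaw x ω (noBacktrack d) := by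
  simp_rw [quenchedLaw_noBacktrack]
  exact Measurable.iInf fun N => measurable_quenchedLaw_stayAbove x _ N

/-- The annealed probability never to go below the starting level. -/
def noBacktrackProb (Q : Measure (SiteLaw d)) : ℝ≥0∞ := annealedLaw Q 0 (noBacktrack d)

theorem lintegral_quenchedLaw_noBacktrack (Q : Measure (SiteLaw d)) [IsProbabilityMeasure Q]
    (x : Site d) : ∫⁻ ω, quenchedLaw x ω (noBacktrack d) ∂envLaw Q = noBacktrackProb Q := by
  rw [noBacktrackProb, annealedLaw_apply Q 0 measurableSet_noBacktrack,
    ← (measurePreserving_translateEnv Q x).lintegral_comp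
      (measurable_quenchedLaw_apply 0 measurableSet_noBacktrack)]
  simp [quenchedLaw_noBacktrack, quenchedLaw_stayAbove_translateEnv]

theorem annealedLaw_noBacktrack (Q : Measure (SiteLaw d)) [IsProbabilityMeasure Q] (x : Site d) :
    annealedLaw Q x (noBacktrack d) = noBacktrackProb Q := by
  rw [annealedLaw_apply Q x measurableSet_noBacktrack, lintegral_quenchedLaw_noBacktrack]

theorem disjoint_levels (L : ℤ) : Disjoint {z : Site d | z 0 < L} {z : Site d | L ≤ z 0} := by
  rw [Set.disjoint_left]
  intro z h1 h2
  simp only [Set.mem_ofPred_eq] at h1 h2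
  omega

theorem Below.mem_levels {l : List (Dir d)} (hl : Below l) (x : Site d) :
    ∀ i < l.length, x + disp (l.take i) ∈ {z : Site d | z 0 < (x + disp l) 0} := by
  intro i hi
  have := hl i hi
  simp only [Set.mem_ofPred_eq, Pi.add_apply]
  omega

/-- The regenerative event of the word `l`: the walk started at `x` first spells `l` and then never
goes below the level reached. If `Below l`, the end of `l` is then a regeneration time. -/
def regenEvent (x : Site d) (l : List (Dir d)) : Set (Traj d) :=
  follows x l ∩ shift l.length ⁻¹' noBacktrack d

theorem measurableSet_regenEvent (x : Site d) (l : List (Dir d)) :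
    MeasurableSet (regenEvent x l) :=
  (measurableSet_follows x l).inter (measurable_shift _ measurableSet_noBacktrack)

/-- The word and the future after it depend on the environment strictly below and at or above the
final level respectively, hence are independent. -/
theorem annealedLaw_regenEvent (Q : Measure (SiteLaw d)) [IsProbabilityMeasure Q] (x : Site d)
    {l : List (Dir d)} (hl : Below l) :
    annealedLaw Q x (regenEvent x l) = wordWeight Q l * noBacktrackProb Q := by
  rw [annealedLaw_apply Q x (measurableSet_regenEvent x l)]
  simp_rw [regenEvent, quenchedLaw_follows_inter _ x l measurableSet_noBacktrack]
  rw [lintegral_envLaw_mul Q (disjoint_levels ((x + disp l) 0))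
    (measurable_pathWeight (hl.mem_levels x)) (measurable_quenchedLaw_noBacktrack (x + disp l)),
    lintegral_pathWeight, lintegral_quenchedLaw_noBacktrack]

/-- Words that occupy disjoint slabs of levels have independent weights. -/
theorem wordWeight_append (Q : Measure (SiteLaw d)) [IsProbabilityMeasure Q]
    {l₁ l₂ : List (Dir d)} (h₁ : Below l₁) (h₂ : Above l₂) :
    wordWeight Q (l₁ ++ l₂) = wordWeight Q l₁ * wordWeight Q l₂ := by
  rw [wordWeight]
  simp_rw [pathWeight_append]
  rw [lintegral_envLaw_mul Q (disjoint_levels ((0 + disp l₁) 0))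
    (measurable_pathWeight (h₁.mem_levels 0)) (measurable_pathWeight ?_),
    lintegral_pathWeight, lintegral_pathWeight]
  intro i hi
  have := h₂ i hi.le
  simp only [Set.mem_ofPred_eq, Pi.add_apply]
  omega

end Levels

/-! ### Combinatorics of regeneration times -/

section NearestNeighbour

variable {d : ℕ}

theorem abs_vec_le (e : Dir d) (i : Fin d) : |e.vec i| ≤ 1 := by
  obtain ⟨j, b⟩ := e
  by_cases h : i = j
  · subst h; cases b <;> simp [Dir.vec]
  · cases b <;> simp [Dir.vec, h]

/-- The steps of the trajectory are nearest-neighbour steps. -/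
def NearestNeighbour (Y : Traj d) : Prop := ∀ n, ∃ e : Dir d, Y (n + 1) = Y n + e.vec

theorem NearestNeighbour.shift {Y : Traj d} (h : NearestNeighbour Y) (m : ℕ) :
    NearestNeighbour (shift m Y) := fun n => h (m + n)

theorem NearestNeighbour.exists_word {Y : Traj d} (h : NearestNeighbour Y) (n : ℕ) :
    ∃ l : List (Dir d), l.length = n ∧ Y ∈ follows (Y 0) l := by
  induction n with
  | zero => exact ⟨[], rfl, fun i hi => by simp at hi; simp [hi]⟩
  | succ n ih =>
    obtain ⟨l, rfl, hl⟩ := ih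
    obtain ⟨e, he⟩ := h l.length
    refine ⟨l ++ [e], by simp, follows_append.2 ⟨hl, fun i hi => ?_⟩⟩
    have h2 := follows_end hl
    have hi' : i = 0 ∨ i = 1 := by simp at hi; omega
    rcases hi' with rfl | rfl
    · simpa [RWRE.shift] using h2
    · simp [RWRE.shift, he, h2]

end NearestNeighbour

section Regeneration

variable {d : ℕ} [NeZero d]

theorem above_nil : Above ([] : List (Dir d)) := by simp [Above]

theorem below_nil : Below ([] : List (Dir d)) := by simp [Below]

theorem Above.append {a b : List (Dir d)} (ha : Above a) (hb : Above b) : Above (a ++ b) := by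
  intro i hi
  rcases le_total i a.length with h | h
  · rw [List.take_append_of_le_length h]
    exact ha i h
  · obtain ⟨j, rfl⟩ := Nat.exists_eq_add_of_le h
    rw [List.take_length_add_append, disp_append]
    have h1 := hb j (by simpa using hi)
    have h2 := ha a.length le_rfl
    rw [List.take_length] at h2
    simp only [Pi.add_apply]
    omega

theorem Above.of_append_left {a b : List (Dir d)} (h : Above (a ++ b)) : Above a := by
  intro i hi
  simpa [List.take_append_of_le_length hi] using h i (by simp; omega)

theorem Below.append {a b : List (Dir d)} (ha : Below a) (hb : Below b) (hb' : Above b) :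
    Below (a ++ b) := by
  intro i hi
  have h2 := hb' b.length le_rfl
  rw [List.take_length] at h2
  rcases lt_or_ge i a.length with h | h
  · rw [List.take_append_of_le_length h.le]
    have h1 := ha i h
    simp only [disp_append, Pi.add_apply]
    omega
  · obtain ⟨j, rfl⟩ := Nat.exists_eq_add_of_le h
    rw [List.take_length_add_append]
    have h1 := hb j (by simpa using hi)
    simp only [disp_append, Pi.add_apply]
    omega

theorem Below.of_append_right {a b : List (Dir d)} (h : Below (a ++ b)) : Below b := by
  intro i hi
  have := h (a.length + i) (by simp; omega)
  rw [List.take_length_add_append] at this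
  simp only [disp_append, Pi.add_apply] at this
  omega

theorem Above.disp_nonneg {l : List (Dir d)} (h : Above l) : 0 ≤ disp l 0 := by
  simpa using h l.length le_rfl

theorem Below.disp_pos {l : List (Dir d)} (h : Below l) (hl : l ≠ []) : 0 < disp l 0 := by
  simpa using h 0 (List.length_pos_iff.2 hl)

/-- The position `i` in the word `l` is a regeneration relative to `l`. -/
def IsCut (l : List (Dir d)) (i : ℕ) : Prop := Below (l.take i) ∧ Above (l.drop i)

/-- A word that can lead from the starting point of a walk that never backtracks to one of its
regeneration positions. -/
structure IsRecordWord (l : List (Dir d)) : Prop where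
  above : Above l
  below : Below l

/-- A word that can be spelled by the walk between two successive regeneration times. -/
structure IsBlock (l : List (Dir d)) : Prop extends IsRecordWord l where
  ne_nil : l ≠ []
  not_isCut : ∀ i, 0 < i → i < l.length → ¬IsCut l i

/-- A word that can be spelled by the walk up to its first regeneration time. -/
structure IsFirstWord (l : List (Dir d)) : Prop where
  below : Below l
  not_isCut : ∀ i < l.length, ¬IsCut l i

theorem IsRecordWord.append {a b : List (Dir d)} (ha : IsRecordWord a) (hb : IsRecordWord b) :
    IsRecordWord (a ++ b) :=
  ⟨ha.above.append hb.above, ha.below.append hb.below hb.above⟩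

theorem isRecordWord_nil : IsRecordWord ([] : List (Dir d)) := ⟨above_nil, below_nil⟩

/-- A nonempty record word starts with a block, which ends at the first cut. -/
theorem IsRecordWord.exists_block {l : List (Dir d)} (h : IsRecordWord l) (hl : l ≠ []) :
    ∃ b l', IsBlock b ∧ IsRecordWord l' ∧ b ++ l' = l := by
  classical
  have hex : ∃ i, 0 < i ∧ IsCut l i :=
    ⟨l.length, List.length_pos_iff.2 hl, by simpa [IsCut] using ⟨h.below, above_nil⟩⟩
  have hi := Nat.find_spec hex
  have hile : Nat.find hex ≤ l.length :=
    Nat.find_min' hex ⟨List.length_pos_iff.2 hl, by simpa [IsCut] using ⟨h.below, above_nil⟩⟩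
  set i := Nat.find hex with hidef
  have hsplit : l.take i ++ l.drop i = l := List.take_append_drop i l
  refine ⟨l.take i, l.drop i, ⟨⟨?_, hi.2.1⟩, ?_, ?_⟩, ⟨hi.2.2, ?_⟩, hsplit⟩
  · exact Above.of_append_left (b := l.drop i) (by rw [hsplit]; exact h.above)
  · rw [← List.length_pos_iff, List.length_take]
    have := List.length_pos_iff.2 hl
    omega
  · intro j hj hj' hcut
    rw [List.length_take] at hj'
    have hji : j < i := by omega
    refine Nat.find_min hex hji ⟨hj, ?_, ?_⟩
    · have := hcut.1
      rwa [List.take_take, min_eq_left hji.le] at this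
    · have h1 : l.drop j = (l.take i).drop j ++ l.drop i := by
        conv_lhs => rw [← hsplit]
        rw [List.drop_append_of_le_length (by rw [List.length_take]; omega)]
      rw [h1]
      exact hcut.2.append hi.2.2
  · exact Below.of_append_right (a := l.take i) (by rw [hsplit]; exact h.below)

theorem follows_level {x : Site d} {l : List (Dir d)} {Y : Traj d} (h : Y ∈ follows x l) {i : ℕ}
    (hi : i ≤ l.length) : Y i 0 = x 0 + disp (l.take i) 0 := by
  rw [h i hi, Pi.add_apply]

theorem follows_below_iff {x : Site d} {l : List (Dir d)} {Y : Traj d} (h : Y ∈ follows x l) :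
    Below l ↔ ∀ s < l.length, Y s 0 < Y l.length 0 := by
  have h1 := follows_level h le_rfl
  rw [List.take_length] at h1
  refine forall₂_congr fun s hs => ?_
  rw [h1, follows_level h hs.le]
  omega

theorem follows_above_iff {x : Site d} {l : List (Dir d)} {Y : Traj d} (h : Y ∈ follows x l) :
    Above l ↔ ∀ s ≤ l.length, Y 0 0 ≤ Y s 0 := by
  refine forall₂_congr fun s hs => ?_
  rw [follows_start h, follows_level h hs]
  omega

theorem regenEvent_append {x : Site d} {l₁ l₂ : List (Dir d)} {Y : Traj d} :
    Y ∈ regenEvent x (l₁ ++ l₂) ↔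
      Y ∈ follows x l₁ ∧ shift l₁.length Y ∈ regenEvent (x + disp l₁) l₂ := by
  simp only [regenEvent, Set.mem_inter_iff, Set.mem_preimage, follows_append, shift_shift,
    List.length_append]
  tauto

theorem regenEvent_subset_noBacktrack {x : Site d} {l : List (Dir d)} (hl : Above l) :
    regenEvent x l ⊆ noBacktrack d := by
  rintro Y ⟨h1, h2⟩ n
  rcases le_total n l.length with h | h
  · exact (follows_above_iff h1).1 hl n h
  · obtain ⟨k, rfl⟩ := Nat.exists_eq_add_of_le h
    exact ((follows_above_iff h1).1 hl _ le_rfl).trans (h2 k)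

theorem regenEvent_of_append {x : Site d} {l₁ l₂ : List (Dir d)} {Y : Traj d} (h₂ : Above l₂)
    (h : Y ∈ regenEvent x (l₁ ++ l₂)) : Y ∈ regenEvent x l₁ :=
  ⟨(regenEvent_append.1 h).1, regenEvent_subset_noBacktrack h₂ (regenEvent_append.1 h).2⟩

theorem isRegenerationTime_iff {Y : Traj d} {t : ℕ} : IsRegenerationTime Y t ↔
    (∀ s < t, Y s 0 < Y t 0) ∧ shift t Y ∈ noBacktrack d := by
  refine and_congr Iff.rfl ⟨fun h n => ?_, fun h s hs => ?_⟩
  · rcases Nat.eq_zero_or_pos n with rfl | hn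
    · exact le_rfl
    · exact h (t + n) (by omega)
  · obtain ⟨k, rfl⟩ := Nat.exists_eq_add_of_le hs.le
    exact h k

theorem isRegenerationTime_zero_iff {Y : Traj d} :
    IsRegenerationTime Y 0 ↔ Y ∈ noBacktrack d := by
  have : shift 0 Y = Y := by funext k; simp [shift]
  simp [isRegenerationTime_iff, this]

theorem measurableSet_isRegenerationTime (t : ℕ) :
    MeasurableSet {Y : Traj d | IsRegenerationTime Y t} := by
  have hm : ∀ n, Measurable fun Y : Traj d => Y n 0 := fun n =>
    (measurable_pi_apply 0).comp (measurable_pi_apply n)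
  have : {Y : Traj d | IsRegenerationTime Y t} =
      (⋂ s, ⋂ (_ : s < t), {Y : Traj d | Y s 0 < Y t 0}) ∩ shift t ⁻¹' noBacktrack d := by
    ext Y; simp [isRegenerationTime_iff]
  rw [this]
  exact (MeasurableSet.iInter fun s => MeasurableSet.iInter fun _ =>
    measurableSet_lt (hm s) (hm t)).inter (measurable_shift t measurableSet_noBacktrack)

theorem IsRegenerationTime.add_iff {Y : Traj d} {m : ℕ} (hm : IsRegenerationTime Y m) (k : ℕ) :
    IsRegenerationTime Y (m + k) ↔ IsRegenerationTime (shift m Y) k := by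
  rw [isRegenerationTime_iff, isRegenerationTime_iff, shift_shift]
  refine and_congr_left fun _ => ⟨fun h s hs => h (m + s) (by omega), fun h s hs => ?_⟩
  rcases lt_or_ge s m with hsm | hsm
  · have h1 := hm.1 s hsm
    rcases Nat.eq_zero_or_pos k with rfl | hk
    · exact h1
    · exact h1.trans_le (hm.2 _ (by omega))
  · obtain ⟨j, rfl⟩ := Nat.exists_eq_add_of_le hsm
    exact h j (by omega)

theorem isRegenerationTime_of_regenEvent {x : Site d} {l : List (Dir d)} {Y : Traj d}
    (hl : Below l) (h : Y ∈ regenEvent x l) : IsRegenerationTime Y l.length :=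
  isRegenerationTime_iff.2 ⟨(follows_below_iff h.1).1 hl, h.2⟩

/-- On a regenerative event the regeneration times before its end are the cuts of the word. -/
theorem isRegenerationTime_iff_isCut {x : Site d} {l : List (Dir d)} {Y : Traj d}
    (h : Y ∈ regenEvent x l) {i : ℕ} (hi : i ≤ l.length) :
    IsRegenerationTime Y i ↔ IsCut l i := by
  have hsplit : l.take i ++ l.drop i = l := List.take_append_drop i l
  have hlen : (l.take i).length = i := by rw [List.length_take]; omega
  have h' := h
  rw [← hsplit, regenEvent_append, hlen] at h'
  have hb := follows_below_iff h'.1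
  rw [hlen] at hb
  rw [isRegenerationTime_iff, IsCut, hb]
  refine and_congr_right fun _ => ⟨fun hD => ?_, fun hA => regenEvent_subset_noBacktrack hA h'.2⟩
  exact (follows_above_iff h'.2.1).2 fun s _ => hD s

theorem exists_regenEvent {Y : Traj d} (h : NearestNeighbour Y) {t : ℕ}
    (ht : IsRegenerationTime Y t) :
    ∃ l : List (Dir d), l.length = t ∧ Below l ∧ Y ∈ regenEvent (Y 0) l := by
  obtain ⟨l, rfl, hl⟩ := h.exists_word t
  rw [isRegenerationTime_iff] at ht
  exact ⟨l, rfl, (follows_below_iff hl).2 ht.1, hl, ht.2⟩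

theorem exists_recordWord {Y : Traj d} (h : NearestNeighbour Y) (hD : Y ∈ noBacktrack d) {t : ℕ}
    (ht : IsRegenerationTime Y t) :
    ∃ l : List (Dir d), l.length = t ∧ IsRecordWord l ∧ Y ∈ regenEvent (Y 0) l := by
  obtain ⟨l, hl, hb, hY⟩ := exists_regenEvent h ht
  exact ⟨l, hl, ⟨(follows_above_iff hY.1).2 fun s _ => hD s, hb⟩, hY⟩

theorem exists_blockWord {Y : Traj d} (h : NearestNeighbour Y) (hD : Y ∈ noBacktrack d)
    (ht : ∃ t, 0 < t ∧ IsRegenerationTime Y t) :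
    ∃ b : List (Dir d), IsBlock b ∧ Y ∈ regenEvent (Y 0) b := by
  classical
  obtain ⟨b, hb, hr, hY⟩ := exists_recordWord h hD (Nat.find_spec ht).2
  refine ⟨b, ⟨hr, ?_, fun i hi hi' hc => ?_⟩, hY⟩
  · rw [← List.length_pos_iff, hb]
    exact (Nat.find_spec ht).1
  · exact Nat.find_min ht (hb ▸ hi') ⟨hi, (isRegenerationTime_iff_isCut hY hi'.le).2 hc⟩

theorem exists_firstWord {Y : Traj d} (h : NearestNeighbour Y)
    (ht : ∃ t, IsRegenerationTime Y t) :
    ∃ l : List (Dir d), IsFirstWord l ∧ Y ∈ regenEvent (Y 0) l := by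
  classical
  obtain ⟨l, hl, hb, hY⟩ := exists_regenEvent h (Nat.find_spec ht)
  refine ⟨l, ⟨hb, fun i hi hc => ?_⟩, hY⟩
  exact Nat.find_min ht (hl ▸ hi) ((isRegenerationTime_iff_isCut hY hi.le).2 hc)

theorem block_unique {x : Site d} {b b' : List (Dir d)} {Y : Traj d} (hb : IsBlock b)
    (hb' : IsBlock b') (h : Y ∈ regenEvent x b) (h' : Y ∈ regenEvent x b') : b = b' := by
  have key : ∀ {b b' : List (Dir d)}, IsBlock b → IsBlock b' → Y ∈ regenEvent x b →
      Y ∈ regenEvent x b' → ¬b.length < b'.length := fun hb hb' h h' hlt =>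
    hb'.not_isCut _ (List.length_pos_iff.2 hb.ne_nil) hlt
      ((isRegenerationTime_iff_isCut h' hlt.le).1 (isRegenerationTime_of_regenEvent hb.below h))
  exact follows_inj h.1 h'.1
    (le_antisymm (not_lt.1 (key hb' hb h' h)) (not_lt.1 (key hb hb' h h')))

theorem firstWord_unique {x : Site d} {b b' : List (Dir d)} {Y : Traj d} (hb : IsFirstWord b)
    (hb' : IsFirstWord b') (h : Y ∈ regenEvent x b) (h' : Y ∈ regenEvent x b') : b = b' := by
  have key : ∀ {b b' : List (Dir d)}, IsFirstWord b → IsFirstWord b' → Y ∈ regenEvent x b →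
      Y ∈ regenEvent x b' → ¬b.length < b'.length := fun hb hb' h h' hlt =>
    hb'.not_isCut _ hlt
      ((isRegenerationTime_iff_isCut h' hlt.le).1 (isRegenerationTime_of_regenEvent hb.below h))
  exact follows_inj h.1 h'.1
    (le_antisymm (not_lt.1 (key hb' hb h' h)) (not_lt.1 (key hb hb' h h')))

/-- A trajectory enters a given level through a strict record at most once. -/
theorem below_unique {x : Site d} {l l' : List (Dir d)} {Y : Traj d} (hl : Below l)
    (hl' : Below l') (h : Y ∈ follows x l) (h' : Y ∈ follows x l') (hlev : disp l 0 = disp l' 0) :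
    l = l' := by
  have e : Y l.length 0 = Y l'.length 0 := by
    rw [follows_end h, follows_end h', Pi.add_apply, Pi.add_apply, hlev]
  refine follows_inj h h' (le_antisymm (not_lt.1 fun hlt => ?_) (not_lt.1 fun hlt => ?_))
  · exact absurd e.symm ((follows_below_iff h).1 hl _ hlt).ne
  · exact absurd e ((follows_below_iff h').1 hl' _ hlt).ne

/-- When the walk spells a first word and then a block, these determine the first two regeneration
times. -/
theorem regenerationTime_of_regenEvent {x : Site d} {l b : List (Dir d)} {Y : Traj d}
    (hl : IsFirstWord l) (hb : IsBlock b) (h : Y ∈ regenEvent x (l ++ b)) :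
    regenerationTime Y 1 = l.length ∧ regenerationTime Y 2 = l.length + b.length := by
  classical
  have h1 := regenEvent_of_append hb.above h
  have h2 := (regenEvent_append.1 h).2
  have r1 := isRegenerationTime_of_regenEvent hl.below h1
  have r2 : IsRegenerationTime Y (l.length + b.length) :=
    (r1.add_iff _).2 (isRegenerationTime_of_regenEvent hb.below h2)
  have hn1 : ∀ i < l.length, ¬IsRegenerationTime Y i := fun i hi hr =>
    hl.not_isCut i hi ((isRegenerationTime_iff_isCut h1 hi.le).1 hr)
  have hn2 : ∀ i, 0 < i → i < b.length → ¬IsRegenerationTime Y (l.length + i) :=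
    fun i hi hi' hr => hb.not_isCut i hi hi'
      ((isRegenerationTime_iff_isCut h2 hi'.le).1 ((r1.add_iff _).1 hr))
  have hbpos := List.length_pos_iff.2 hb.ne_nil
  have c1 : Nat.count (IsRegenerationTime Y) l.length = 0 := by
    rw [Nat.count_eq_card_filter_range, Finset.card_eq_zero, Finset.filter_eq_empty_iff]
    exact fun i hi => hn1 i (Finset.mem_range.1 hi)
  have c2 : Nat.count (IsRegenerationTime Y) (l.length + b.length) = 1 := by
    rw [Nat.count_eq_card_filter_range, Finset.card_eq_one]
    refine ⟨l.length, Finset.ext fun i => ?_⟩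
    simp only [Finset.mem_filter, Finset.mem_range, Finset.mem_singleton]
    constructor
    · rintro ⟨hi, hr⟩
      rcases lt_trichotomy i l.length with hlt | heq | hgt
      · exact absurd hr (hn1 i hlt)
      · exact heq
      · obtain ⟨j, rfl⟩ := Nat.exists_eq_add_of_le hgt.le
        exact absurd hr (hn2 j (by omega) (by omega))
    · rintro rfl
      exact ⟨by omega, r1⟩
  constructor
  · have := Nat.nth_count r1
    rwa [c1] at this
  · have := Nat.nth_count r2
    rwa [c2] at this

end Regeneration

/-! ### The renewal structure of the conditioned walk -/

section Renewal

variable {d : ℕ} [NeZero d]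

/-- The record words. -/
abbrev RecordWord (d : ℕ) [NeZero d] : Type := {l : List (Dir d) // IsRecordWord l}

/-- The blocks. -/
abbrev Block (d : ℕ) [NeZero d] : Type := {l : List (Dir d) // IsBlock l}

/-- The first words. -/
abbrev FirstWord (d : ℕ) [NeZero d] : Type := {l : List (Dir d) // IsFirstWord l}

/-- Summing over record words is at most summing over the empty word and over the decompositions
into a block and a record word. -/
theorem tsum_recordWord_le (f : List (Dir d) → ℝ≥0∞) :
    ∑' l : RecordWord d, f l.1 ≤
      f [] + ∑' b : Block d, ∑' l : RecordWord d, f (b.1 ++ l.1) := by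
  let φ : Unit ⊕ (Block d × RecordWord d) → RecordWord d := Sum.elim
    (fun _ => ⟨[], isRecordWord_nil⟩)
    (fun p => ⟨p.1.1 ++ p.2.1, p.1.2.toIsRecordWord.append p.2.2⟩)
  have hφ : Function.Surjective φ := by
    rintro ⟨l, hl⟩
    by_cases h : l = []
    · subst h
      exact ⟨Sum.inl (), rfl⟩
    · obtain ⟨b, l', hb, hl', rfl⟩ := hl.exists_block h
      exact ⟨Sum.inr (⟨b, hb⟩, ⟨l', hl'⟩), rfl⟩
  refine (ENNReal.tsum_le_tsum_comp_of_surjective hφ fun l => f l.1).trans_eq ?_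
  rw [Summable.tsum_sum ENNReal.summable ENNReal.summable, tsum_fintype]
  simp only [Finset.univ_unique, Finset.sum_singleton]
  exact congrArg₂ _ rfl (ENNReal.tsum_prod (f := fun (b : Block d) (l : RecordWord d) => f (b.1 ++ l.1)))

/-- The trajectories that drift to infinity in the direction `e_1`. -/
def Transient (Y : Traj d) : Prop := Tendsto (fun n => Y n 0) atTop atTop

theorem Transient.exists_min {Y : Traj d} (h : Transient Y) : ∃ n, shift n Y ∈ noBacktrack d := by
  have h' : Tendsto (fun n => Y n 0) cofinite atTop := by rwa [Nat.cofinite_eq_atTop]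
  obtain ⟨n, hn⟩ := h'.exists_forall_le
  exact ⟨n, fun k => hn (n + k)⟩

/-- A transient trajectory enters every level above its starting level through a strict record. -/
theorem exists_recordWord_of_level {Y : Traj d} (hT : Transient Y) (hN : NearestNeighbour Y)
    (hD : Y ∈ noBacktrack d) (ℓ : ℕ) :
    ∃ l : List (Dir d), IsRecordWord l ∧ Y ∈ follows (Y 0) l ∧ disp l 0 = ℓ := by
  classical
  have hex : ∃ n, Y 0 0 + ℓ ≤ Y n 0 := (hT.eventually_ge_atTop _).exists
  have hfind := Nat.find_spec hex
  have hmin : ∀ m < Nat.find hex, Y m 0 < Y 0 0 + ℓ := fun m hm => not_le.1 (Nat.find_min hex hm)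
  have heq : Y (Nat.find hex) 0 = Y 0 0 + ℓ := by
    refine le_antisymm ?_ hfind
    rcases h : Nat.find hex with _ | n
    · omega
    · obtain ⟨e, he⟩ := hN n
      have h1 := hmin n (by omega)
      have h2 := (abs_le.1 (abs_vec_le e 0)).2
      rw [he, Pi.add_apply]
      omega
  obtain ⟨l, hl, hf⟩ := hN.exists_word (Nat.find hex)
  rw [← hl] at heq hmin
  refine ⟨l, ⟨(follows_above_iff hf).2 fun s _ => hD s, (follows_below_iff hf).2 fun s hs => ?_⟩,
    hf, ?_⟩
  · rw [heq]; exact hmin s hs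
  · have := follows_end hf
    rw [this, Pi.add_apply] at heq
    omega

variable (Q : Measure (SiteLaw d)) [IsProbabilityMeasure Q]

theorem noBacktrackProb_ne_top : noBacktrackProb Q ≠ ∞ := measure_ne_top _ _

variable {Q}

/-- A transient walk has a positive probability never to backtrack, since it attains its minimal
level. -/
theorem noBacktrackProb_ne_zero (hT : ∀ᵐ Y ∂annealedLaw Q 0, Transient Y) :
    noBacktrackProb Q ≠ 0 := by
  intro h0
  have h1 : ∀ n, ∀ᵐ Y ∂annealedLaw Q 0, shift n Y ∉ noBacktrack d := fun n =>
    measure_eq_zero_iff_ae_notMem.1 (annealedLaw_shift_null Q measurableSet_noBacktrack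
      (fun x => by rw [annealedLaw_noBacktrack, h0]) 0 n)
  have h2 : ∀ᵐ Y ∂annealedLaw Q 0, False := by
    filter_upwards [hT, ae_all_iff.2 h1] with Y hY hY'
    obtain ⟨n, hn⟩ := hY.exists_min
    exact hY' n hn
  rw [ae_iff] at h2
  simp at h2

theorem tsum_block_mul (x : Site d) : (∑' b : Block d, wordWeight Q b.1) * noBacktrackProb Q =
    annealedLaw Q x (⋃ b : Block d, regenEvent x b.1) := by
  have hdisj : Pairwise (Function.onFun Disjoint fun b : Block d => regenEvent x b.1) :=
    fun b b' hbb => Set.disjoint_left.2 fun Y h h' =>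
      hbb (Subtype.ext (block_unique b.2 b'.2 h h'))
  rw [measure_iUnion hdisj fun b => measurableSet_regenEvent x b.1, ← ENNReal.tsum_mul_right]
  exact tsum_congr fun b => (annealedLaw_regenEvent Q x b.2.below).symm

theorem iUnion_block_subset (x : Site d) :
    ⋃ b : Block d, regenEvent x b.1 ⊆ noBacktrack d :=
  Set.iUnion_subset fun b => regenEvent_subset_noBacktrack b.2.above

/-- The total weight of the record words that end at a given level. -/
def levelWeight (Q : Measure (SiteLaw d)) (ℓ : ℤ) : ℝ≥0∞ :=
  ∑' l : RecordWord d, if disp l.1 0 = ℓ then wordWeight Q l.1 else 0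

/-- The walk enters a given level through a strict record at most once, so the regenerative events
summed here are disjoint. -/
theorem levelWeight_le_one (hp : noBacktrackProb Q ≠ 0) (ℓ : ℤ) : levelWeight Q ℓ ≤ 1 := by
  have h : levelWeight Q ℓ * noBacktrackProb Q ≤ 1 * noBacktrackProb Q := by
    rw [levelWeight, ← ENNReal.tsum_mul_right, one_mul]
    calc ∑' l : RecordWord d, (if disp l.1 0 = ℓ then wordWeight Q l.1 else 0) * noBacktrackProb Q
        = ∑' l : RecordWord d, annealedLaw Q 0
            (if disp l.1 0 = ℓ then regenEvent 0 l.1 else ∅) := tsum_congr fun l => by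
          split_ifs
          · rw [annealedLaw_regenEvent Q 0 l.2.below]
          · simp
      _ = annealedLaw Q 0
            (⋃ l : RecordWord d, if disp l.1 0 = ℓ then regenEvent 0 l.1 else ∅) := by
          rw [measure_iUnion]
          · intro l l' hll
            refine Set.disjoint_left.2 fun Y h h' => hll (Subtype.ext ?_)
            simp only at h h'
            split_ifs at h h' with h1 h2 <;> try exact absurd ‹_› (Set.notMem_empty _)
            exact below_unique l.2.below l'.2.below h.1 h'.1 (h1.trans h2.symm)
          · intro l
            split_ifs
            · exact measurableSet_regenEvent _ _
            · exact MeasurableSet.empty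
      _ ≤ annealedLaw Q 0 (noBacktrack d) := measure_mono (Set.iUnion_subset fun l => by
          split_ifs
          · exact regenEvent_subset_noBacktrack l.2.above
          · exact Set.empty_subset _)
  exact (ENNReal.mul_le_mul_iff_left hp (noBacktrackProb_ne_top Q)).1 h

theorem noBacktrackProb_le_levelWeight (hT : ∀ᵐ Y ∂annealedLaw Q 0, Transient Y) (ℓ : ℕ) :
    noBacktrackProb Q ≤ levelWeight Q ℓ := by
  calc noBacktrackProb Q = annealedLaw Q 0 (noBacktrack d) := rfl
    _ ≤ annealedLaw Q 0
          (⋃ l : RecordWord d, if disp l.1 0 = ℓ then follows 0 l.1 else ∅) := by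
        refine measure_mono_ae ?_
        filter_upwards [hT, annealedLaw_steps Q 0, annealedLaw_start Q 0] with Y h1 h2 h3 hD
        obtain ⟨l, hl, hf, hlev⟩ := exists_recordWord_of_level h1 h2 hD ℓ
        refine Set.mem_iUnion.2 ⟨⟨l, hl⟩, ?_⟩
        rw [if_pos hlev, ← h3]
        exact hf
    _ ≤ ∑' l : RecordWord d, annealedLaw Q 0 (if disp l.1 0 = ℓ then follows 0 l.1 else ∅) :=
        measure_iUnion_le _
    _ = levelWeight Q ℓ := tsum_congr fun l => by
        split_ifs
        · rw [annealedLaw_follows]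
        · simp

/-- The block weights form a probability distribution. If their sum were less than one, the expected
number of regeneration levels would be finite, whereas every level has probability at least
`noBacktrackProb Q` to be one. -/
theorem tsum_block (hT : ∀ᵐ Y ∂annealedLaw Q 0, Transient Y) :
    ∑' b : Block d, wordWeight Q b.1 = 1 := by
  have hp := noBacktrackProb_ne_zero hT
  have hq : ∑' b : Block d, wordWeight Q b.1 ≤ 1 := by
    rw [← ENNReal.mul_le_mul_iff_left hp (noBacktrackProb_ne_top Q), tsum_block_mul 0, one_mul]
    exact measure_mono (iUnion_block_subset 0)
  set q := ∑' b : Block d, wordWeight Q b.1 with hqdef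
  by_contra hne
  have hlt : 0 < 1 - q := tsub_pos_iff_lt.2 (lt_of_le_of_ne hq hne)
  -- `G L` is the expected number of regeneration levels below `L` of the conditioned walk. It is at
  -- least `L * noBacktrackProb Q`, and the renewal inequality bounds it by `1 / (1 - q)`.
  let G : ℕ → ℝ≥0∞ := fun L =>
    ∑' l : RecordWord d, if disp l.1 0 < L then wordWeight Q l.1 else 0
  have hG : ∀ L, G L = ∑ ℓ ∈ Finset.range L, levelWeight Q ℓ := fun L => by
    simp only [levelWeight]
    rw [← Summable.tsum_finsetSum fun _ _ => ENNReal.summable]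
    refine tsum_congr fun l => ?_
    obtain ⟨n, hn⟩ := Int.eq_ofNat_of_zero_le l.2.above.disp_nonneg
    rw [hn]
    simp
  have hGtop : ∀ L, G L ≠ ∞ := fun L => by
    rw [hG]
    exact (ENNReal.sum_lt_top.2 fun (ℓ : ℕ) _ =>
      (levelWeight_le_one hp (ℓ : ℤ)).trans_lt ENNReal.one_lt_top).ne
  have hGp : ∀ L : ℕ, L * noBacktrackProb Q ≤ G L := fun L => by
    rw [hG]
    calc (L : ℝ≥0∞) * noBacktrackProb Q = ∑ _ℓ ∈ Finset.range L, noBacktrackProb Q := by simp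
      _ ≤ _ := Finset.sum_le_sum fun ℓ _ => noBacktrackProb_le_levelWeight hT ℓ
  have hGrec : ∀ L, G L ≤ 1 + q * G L := fun L => by
    refine (tsum_recordWord_le fun l => if disp l 0 < L then wordWeight Q l else 0).trans ?_
    refine add_le_add ?_ ?_
    · split_ifs
      · rw [wordWeight_nil]
      · exact zero_le
    · rw [hqdef, ← ENNReal.tsum_mul_right]
      refine ENNReal.tsum_le_tsum fun b => ?_
      rw [← ENNReal.tsum_mul_left]
      refine ENNReal.tsum_le_tsum fun l => ?_
      have hb := b.2.above.disp_nonneg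
      split_ifs with h1 h2
      · rw [wordWeight_append Q b.2.below l.2.above]
      · rw [disp_append, Pi.add_apply] at h1
        omega
      · exact zero_le
      · simp
  have hG1 : ∀ L, G L * (1 - q) ≤ 1 := fun L => by
    have h1 : G L * (1 - q) + q * G L = G L := by
      rw [mul_comm q, ← mul_add, tsub_add_cancel_of_le hq, mul_one]
    have h2 : q * G L ≠ ∞ := ENNReal.mul_ne_top (ne_top_of_le_ne_top ENNReal.one_ne_top hq) (hGtop L)
    refine (ENNReal.add_le_add_iff_right h2).1 ?_
    rw [h1]
    exact hGrec L
  obtain ⟨L, hL⟩ := ENNReal.exists_nat_mul_gt (a := noBacktrackProb Q * (1 - q))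
    (mul_ne_zero hp hlt.ne') ENNReal.one_ne_top
  refine absurd (hG1 L) (not_le.2 (hL.trans_le ?_))
  rw [← mul_assoc]
  exact mul_le_mul' (hGp L) le_rfl

/-- Almost surely, a walk that never backtracks from some time on regenerates after that time. -/
theorem ae_exists_regeneration (hT : ∀ᵐ Y ∂annealedLaw Q 0, Transient Y) (x : Site d) :
    ∀ᵐ Y ∂annealedLaw Q x, ∀ n, shift n Y ∈ noBacktrack d →
      ∃ t, 0 < t ∧ IsRegenerationTime (shift n Y) t := by
  set A : Set (Traj d) := noBacktrack d ∩ (⋃ t, ⋃ (_ : 0 < t), {Y | IsRegenerationTime Y t})ᶜ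
  have hA : MeasurableSet A := measurableSet_noBacktrack.inter
    (MeasurableSet.iUnion fun t => MeasurableSet.iUnion fun _ =>
      measurableSet_isRegenerationTime t).compl
  have h0 : ∀ x, annealedLaw Q x A = 0 := fun x => by
    have hm : MeasurableSet (⋃ b : Block d, regenEvent x b.1) :=
      MeasurableSet.iUnion fun b => measurableSet_regenEvent x b.1
    have h1 : annealedLaw Q x (noBacktrack d \ ⋃ b : Block d, regenEvent x b.1) = 0 := by
      rw [measure_sdiff (iUnion_block_subset x) hm.nullMeasurableSet (measure_ne_top _ _),
        ← tsum_block_mul, tsum_block hT, one_mul, annealedLaw_noBacktrack, tsub_self]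
    refine measure_mono_null (fun Y hY => Set.mem_sdiff_of_mem hY.1 fun hU => hY.2 ?_) h1
    obtain ⟨b, hb⟩ := Set.mem_iUnion.1 hU
    refine Set.mem_iUnion₂.2 ⟨b.1.length, List.length_pos_iff.2 b.2.ne_nil, ?_⟩
    exact isRegenerationTime_of_regenEvent b.2.below hb
  rw [ae_all_iff]
  intro n
  filter_upwards [measure_eq_zero_iff_ae_notMem.1 (annealedLaw_shift_null Q hA h0 x n)] with Y hY hD
  by_contra hne
  refine hY ⟨hD, fun hU => hne ?_⟩
  obtain ⟨t, ht, hr⟩ := Set.mem_iUnion₂.1 hU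
  exact ⟨t, ht, hr⟩

/-- Every time of a conditioned walk lies in a block between two regeneration times. -/
theorem exists_word_block {Y : Traj d} (hN : NearestNeighbour Y) (hD : Y ∈ noBacktrack d)
    (hr : ∀ n, shift n Y ∈ noBacktrack d → ∃ t, 0 < t ∧ IsRegenerationTime (shift n Y) t)
    (n : ℕ) : ∃ (l : RecordWord d) (b : Block d), Y ∈ regenEvent (Y 0) (l.1 ++ b.1) ∧
      l.1.length ≤ n ∧ n < l.1.length + b.1.length := by
  classical
  set t := Nat.findGreatest (IsRegenerationTime Y) n
  have ht : IsRegenerationTime Y t :=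
    Nat.findGreatest_spec (Nat.zero_le n) (isRegenerationTime_zero_iff.2 hD)
  have htn : t ≤ n := Nat.findGreatest_le n
  have htD := (isRegenerationTime_iff.1 ht).2
  obtain ⟨l, hl, hlr, hlY⟩ := exists_recordWord hN hD ht
  obtain ⟨b, hb, hbY⟩ := exists_blockWord (hN.shift t) htD (hr t htD)
  refine ⟨⟨l, hlr⟩, ⟨b, hb⟩, ?_, by simpa [hl] using htn, ?_⟩
  · rw [regenEvent_append, hl, ← follows_end hlY.1, hl]
    exact ⟨hlY.1, hbY⟩
  · by_contra hlt
    have h1 : IsRegenerationTime Y (t + b.length) :=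
      (ht.add_iff _).2 (isRegenerationTime_of_regenEvent hb.below hbY)
    have h2 : t + b.length ≤ t := Nat.le_findGreatest (by simpa [hl] using hlt) h1
    have := List.length_pos_iff.2 hb.ne_nil
    omega

/-- A transient trajectory has a regeneration time: one of the path after the global minimum, at a
level that was not reached before the minimum. -/
theorem exists_isRegenerationTime {Y : Traj d} (hT : Transient Y)
    (hr : ∀ n, shift n Y ∈ noBacktrack d → ∃ t, 0 < t ∧ IsRegenerationTime (shift n Y) t) :
    ∃ t, IsRegenerationTime Y t := by
  obtain ⟨n, hn⟩ := hT.exists_min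
  have hinf : ∀ N, ∃ t, N ≤ t ∧ IsRegenerationTime (shift n Y) t := fun N => by
    induction N with
    | zero => exact ⟨0, le_rfl, isRegenerationTime_zero_iff.2 hn⟩
    | succ N ih =>
      obtain ⟨t, htN, ht⟩ := ih
      have htD := (isRegenerationTime_iff.1 ht).2
      rw [shift_shift] at htD
      obtain ⟨s, hs, hs'⟩ := hr (n + t) htD
      refine ⟨t + s, by omega, (ht.add_iff s).2 ?_⟩
      rwa [shift_shift]
  -- `B` exceeds every level visited before the global minimum at time `n`.
  obtain ⟨B, hB⟩ : ∃ B : ℤ, ∀ s < n, Y s 0 < B := by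
    refine ⟨∑ s ∈ Finset.range n, |Y s 0| + 1, fun s hs => ?_⟩
    have h1 := Finset.single_le_sum (f := fun s => |Y s 0|) (fun i _ => abs_nonneg _)
      (Finset.mem_range.2 hs)
    have h2 := le_abs_self (Y s 0)
    omega
  obtain ⟨N, hN⟩ := eventually_atTop.1 (hT.eventually_ge_atTop B)
  obtain ⟨t, htN, ht⟩ := hinf N
  rw [isRegenerationTime_iff, shift_shift] at ht
  refine ⟨n + t, isRegenerationTime_iff.2 ⟨fun s hs => ?_, ht.2⟩⟩
  rcases lt_or_ge s n with h | h
  · exact (hB s h).trans_le (hN _ (by omega))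
  · obtain ⟨k, rfl⟩ := Nat.exists_eq_add_of_le h
    exact ht.1 k (by omega)

/-- Almost surely there is a regeneration time, so the first words exhaust the probability space. -/
theorem one_le_tsum_firstWord (hT : ∀ᵐ Y ∂annealedLaw Q 0, Transient Y) :
    1 ≤ ∑' l : FirstWord d, wordWeight Q l.1 * noBacktrackProb Q := by
  calc (1 : ℝ≥0∞) = annealedLaw Q 0 Set.univ := measure_univ.symm
    _ ≤ annealedLaw Q 0 (⋃ l : FirstWord d, regenEvent 0 l.1) := by
        refine measure_mono_ae ?_
        filter_upwards [hT, annealedLaw_steps Q 0, annealedLaw_start Q 0,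
          ae_exists_regeneration hT 0] with Y h1 h2 h3 h4 _
        obtain ⟨l, hl, hY⟩ := exists_firstWord h2 (exists_isRegenerationTime h1 h4)
        rw [h3] at hY
        exact Set.mem_iUnion.2 ⟨⟨l, hl⟩, hY⟩
    _ ≤ ∑' l : FirstWord d, annealedLaw Q 0 (regenEvent 0 l.1) := measure_iUnion_le _
    _ = _ := tsum_congr fun l => annealedLaw_regenEvent Q 0 l.2.below

/-- The length of a block has the law of `t^{(2)} - t^{(1)}`; its moments are bounded by those
of `t^{(2)} - t^{(1)}`. -/
theorem tsum_block_length_rpow_le (hT : ∀ᵐ Y ∂annealedLaw Q 0, Transient Y) (r : ℝ) :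
    ∑' b : Block d, wordWeight Q b.1 * (b.1.length : ℝ≥0∞) ^ r ≤ regenerationMoment Q r := by
  set m := ∑' b : Block d, wordWeight Q b.1 * (b.1.length : ℝ≥0∞) ^ r
  have hmul : ∀ p : FirstWord d × Block d,
      ∫⁻ X in regenEvent 0 (p.1.1 ++ p.2.1),
        ((regenerationTime X 2 - regenerationTime X 1 : ℕ) : ℝ≥0∞) ^ r ∂annealedLaw Q 0 =
      wordWeight Q p.1.1 * noBacktrackProb Q *
        (wordWeight Q p.2.1 * (p.2.1.length : ℝ≥0∞) ^ r) := fun p => by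
    have hb : Below (p.1.1 ++ p.2.1) := p.1.2.below.append p.2.2.below p.2.2.above
    rw [setLIntegral_congr_fun (g := fun _ => (p.2.1.length : ℝ≥0∞) ^ r)
      (measurableSet_regenEvent _ _) fun X hX => ?_, setLIntegral_const,
      annealedLaw_regenEvent Q 0 hb, wordWeight_append Q p.1.2.below p.2.2.above]
    · ring
    · obtain ⟨h1, h2⟩ := regenerationTime_of_regenEvent p.1.2 p.2.2 hX
      simp only [h1, h2, Nat.add_sub_cancel_left]
  have hdisj : Pairwise (Function.onFun Disjoint fun p : FirstWord d × Block d =>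
      regenEvent (0 : Site d) (p.1.1 ++ p.2.1)) := by
    rintro ⟨l, b⟩ ⟨l', b'⟩ hne
    refine Set.disjoint_left.2 fun Y h h' => hne ?_
    have hl : l = l' := Subtype.ext (firstWord_unique l.2 l'.2
      (regenEvent_of_append b.2.above h) (regenEvent_of_append b'.2.above h'))
    subst hl
    have hb : b = b' := Subtype.ext
      (block_unique b.2 b'.2 (regenEvent_append.1 h).2 (regenEvent_append.1 h').2)
    rw [hb]
  calc m = 1 * m := (one_mul m).symm
    _ ≤ (∑' l : FirstWord d, wordWeight Q l.1 * noBacktrackProb Q) * m :=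
        mul_le_mul' (one_le_tsum_firstWord hT) le_rfl
    _ = ∑' p : FirstWord d × Block d, wordWeight Q p.1.1 * noBacktrackProb Q *
        (wordWeight Q p.2.1 * (p.2.1.length : ℝ≥0∞) ^ r) := by
        rw [ENNReal.tsum_prod (f := fun (l : FirstWord d) (b : Block d) => wordWeight Q l.1 * noBacktrackProb Q *
          (wordWeight Q b.1 * (b.1.length : ℝ≥0∞) ^ r)), ← ENNReal.tsum_mul_right]
        exact tsum_congr fun l => ENNReal.tsum_mul_left.symm
    _ = ∫⁻ X in ⋃ p : FirstWord d × Block d, regenEvent 0 (p.1.1 ++ p.2.1),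
        ((regenerationTime X 2 - regenerationTime X 1 : ℕ) : ℝ≥0∞) ^ r ∂annealedLaw Q 0 := by
        rw [lintegral_iUnion (fun p => measurableSet_regenEvent _ _) hdisj]
        exact tsum_congr fun p => (hmul p).symm
    _ ≤ regenerationMoment Q r := setLIntegral_le_lintegral _ _

end Renewal

/-! ### Transience from the law of large numbers -/

section Transience

variable {d : ℕ} [NeZero d] {Q : Measure (SiteLaw d)}

theorem LawOfLargeNumbers.transient {v : EuclideanSpace ℝ (Fin d)} (h : LawOfLargeNumbers Q v)
    (hv : 0 < v 0) : ∀ᵐ Y ∂annealedLaw Q 0, Transient Y := by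
  filter_upwards [h] with Y hY
  rw [Transient, ← tendsto_intCast_atTop_iff (R := ℝ)]
  refine ((hY 0).pos_mul_atTop hv tendsto_natCast_atTop_atTop).congr' ?_
  filter_upwards [eventually_ne_atTop 0] with n hn
  have : (n : ℝ) ≠ 0 := Nat.cast_ne_zero.2 hn
  field_simp

end Transience

/-! ### Elementary blocks under uniform ellipticity -/

section Ellipticity

variable {d : ℕ} {Q : Measure (SiteLaw d)} [IsProbabilityMeasure Q]

theorem pow_le_wordWeight {κ : ℝ} (hQ : UniformlyElliptic Q κ) (l : List (Dir d)) :
    ENNReal.ofReal κ ^ l.length ≤ wordWeight Q l := by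
  have hae : ∀ᵐ ω ∂envLaw Q, ∀ (x : Site d) (e : Dir d), κ ≤ (ω x).1 e := by
    rw [ae_all_iff]
    intro x
    rw [ae_all_iff]
    intro e
    have h1 : ∀ᵐ p ∂Q, κ ≤ p.1 e := by
      rw [ae_iff]
      simpa using hQ.2 e
    exact (measurePreserving_eval_infinitePi (fun _ : Site d => Q) x).quasiMeasurePreserving.ae h1
  have key : ∀ ω : Env d, (∀ (x : Site d) (e : Dir d), κ ≤ (ω x).1 e) → ∀ x,
      ENNReal.ofReal κ ^ l.length ≤ pathWeight ω x l := fun ω hω => by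
    induction l with
    | nil => simp [pathWeight]
    | cons e l ih =>
      intro x
      rw [List.length_cons, pow_succ', pathWeight]
      exact mul_le_mul' (ENNReal.ofReal_le_ofReal (hω x e)) (ih _)
  calc ENNReal.ofReal κ ^ l.length = ∫⁻ _, ENNReal.ofReal κ ^ l.length ∂envLaw Q := by simp
    _ ≤ wordWeight Q l := lintegral_mono_ae (hae.mono fun ω hω => key ω hω 0)

variable [NeZero d]

/-- Some transversal steps `e_i`, `i ∈ s`, followed by the step `e_1`. -/
def elementaryWord (s : Finset (Fin d)) : List (Dir d) :=
  s.toList.map (fun i => (i, true)) ++ [(0, true)]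

/-- The displacement of an elementary word. -/
def elementaryDisp (s : Finset (Fin d)) : Site d :=
  ∑ i ∈ s, Pi.single i 1 + Pi.single 0 1

theorem disp_elementaryWord (s : Finset (Fin d)) :
    disp (elementaryWord s) = elementaryDisp s := by
  rw [elementaryWord, elementaryDisp, disp_append]
  congr 1
  · rw [disp, List.map_map, Finset.sum_eq_multiset_sum]
    conv_rhs => rw [← Finset.coe_toList s]
    rfl
  · simp [disp, Dir.vec]

theorem isBlock_elementaryWord {s : Finset (Fin d)} (hs : (0 : Fin d) ∉ s) :
    IsBlock (elementaryWord s) := by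
  set t := s.toList.map (fun i => ((i, true) : Dir d)) with ht
  have hlev : ∀ i, disp (t.take i) 0 = 0 := fun i => by
    have : ∀ u : List (Dir d), (∀ e ∈ u, Dir.vec e 0 = 0) → disp u 0 = 0 := fun u hu => by
      induction u with
      | nil => rfl
      | cons e u ih =>
        rw [disp_cons, Pi.add_apply, hu e (by simp), ih fun e he => hu e (by simp [he]), add_zero]
    refine this _ fun e he => ?_
    have he' := List.mem_of_mem_take he
    rw [ht, List.mem_map] at he'
    obtain ⟨j, hj, rfl⟩ := he'
    have hj0 : (0 : Fin d) ≠ j := fun h => hs (h ▸ Finset.mem_toList.1 hj)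
    simp [Dir.vec, hj0]
  have hlen : (elementaryWord s).length = t.length + 1 := by simp [elementaryWord, ht]
  have hend : disp (elementaryWord s) 0 = 1 := by
    have := hlev t.length
    rw [List.take_length] at this
    rw [elementaryWord, disp_append, Pi.add_apply, this]
    simp [disp, Dir.vec]
  have htake : ∀ i < (elementaryWord s).length, disp ((elementaryWord s).take i) 0 = 0 :=
    fun i hi => by
      rw [elementaryWord, List.take_append_of_le_length (show i ≤ t.length by omega)]
      exact hlev i
  refine ⟨⟨fun i hi => ?_, fun i hi => ?_⟩, by simp [elementaryWord], fun i h0 hi hc => ?_⟩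
  · rcases hi.lt_or_eq with h | h
    · rw [htake i h]
    · rw [h, List.take_length, hend]
      exact zero_le_one
  · rw [htake i hi, hend]
    exact zero_lt_one
  · have := hc.1.disp_pos fun h => by
      have := congrArg List.length h
      rw [List.length_take, List.length_nil] at this
      omega
    rw [htake i hi] at this
    exact lt_irrefl _ this

theorem pow_le_wordWeight_elementaryWord {κ : ℝ} (hQ : UniformlyElliptic Q κ) (hκ : κ ≤ 1)
    {s : Finset (Fin d)} (hs : (0 : Fin d) ∉ s) :
    ENNReal.ofReal κ ^ d ≤ wordWeight Q (elementaryWord s) := by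
  refine le_trans ?_ (pow_le_wordWeight hQ _)
  refine pow_le_pow_right_of_le_one' (by simpa using hκ) ?_
  have : s.card < d := by
    simpa using Finset.card_lt_univ_of_notMem hs
  simpa [elementaryWord] using this

theorem UniformlyElliptic.le_one {κ : ℝ} (hQ : UniformlyElliptic Q κ) : κ ≤ 1 := by
  by_contra h
  have h1 := hQ.2 (0, true)
  have h2 : {p : SiteLaw d | p.1 (0, true) < κ} = Set.univ := by
    ext p
    simp only [Set.mem_ofPred_eq, Set.mem_univ, iff_true]
    exact (stdSimplex.le_one p _).trans_lt (not_le.1 h)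
  rw [h2, measure_univ] at h1
  exact one_ne_zero h1

end Ellipticity

/-! ### From intersections to pairs of blocks -/

section Intersection

variable {d : ℕ}

theorem norm_disp_le (l : List (Dir d)) : ‖disp l‖ ≤ l.length := by
  induction l with
  | nil => simp
  | cons e l ih =>
    rw [disp_cons, List.length_cons]
    have h1 : ‖e.vec‖ ≤ 1 := by
      rw [pi_norm_le_iff_of_nonneg zero_le_one]
      intro i
      rw [Int.norm_eq_abs]
      exact_mod_cast abs_vec_le e i
    push_cast
    linarith [norm_add_le e.vec (disp l)]

variable [NeZero d]

theorem exists_record_block_near {Y : Traj d} (hN : NearestNeighbour Y) (hD : Y ∈ noBacktrack d)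
    (hr : ∀ n, shift n Y ∈ noBacktrack d → ∃ t, 0 < t ∧ IsRegenerationTime (shift n Y) t)
    (n : ℕ) : ∃ (l : RecordWord d) (b : Block d), Y ∈ regenEvent (Y 0) (l.1 ++ b.1) ∧
      ‖Y n - (Y 0 + disp l.1)‖ ≤ b.1.length := by
  obtain ⟨l, b, hY, h1, h2⟩ := exists_word_block hN hD hr n
  refine ⟨l, b, hY, ?_⟩
  have h3 := (regenEvent_append.1 hY).2.1
  obtain ⟨k, rfl⟩ := Nat.exists_eq_add_of_le h1
  have h4 := h3 k (by omega)
  rw [shift] at h4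
  rw [h4, add_sub_cancel_left]
  refine (norm_disp_le _).trans ?_
  exact_mod_cast (List.length_take_le _ _).trans (by omega)

variable {Q : Measure (SiteLaw d)} [IsProbabilityMeasure Q]

theorem cond_regenEvent (hp : noBacktrackProb Q ≠ 0) (x : Site d) (l : RecordWord d)
    (b : Block d) : cond (annealedLaw Q x) (noBacktrack d) (regenEvent x (l.1 ++ b.1)) ≤
      wordWeight Q l.1 * wordWeight Q b.1 := by
  rw [cond_apply measurableSet_noBacktrack, annealedLaw_noBacktrack]
  calc (noBacktrackProb Q)⁻¹ * annealedLaw Q x (noBacktrack d ∩ regenEvent x (l.1 ++ b.1))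
      ≤ (noBacktrackProb Q)⁻¹ * annealedLaw Q x (regenEvent x (l.1 ++ b.1)) :=
        mul_le_mul' le_rfl (measure_mono Set.inter_subset_right)
    _ = wordWeight Q l.1 * wordWeight Q b.1 := by
        rw [annealedLaw_regenEvent Q x (l.2.append b.2.toIsRecordWord).below,
          wordWeight_append Q l.2.below b.2.above, mul_comm, mul_assoc,
          ENNReal.mul_inv_cancel hp (noBacktrackProb_ne_top Q), mul_one]

theorem ae_cond_record_block (hT : ∀ᵐ Y ∂annealedLaw Q 0, Transient Y) (x : Site d) :
    ∀ᵐ Y ∂cond (annealedLaw Q x) (noBacktrack d), ∀ n, ∃ (l : RecordWord d) (b : Block d),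
      Y ∈ regenEvent x (l.1 ++ b.1) ∧ ‖Y n - (x + disp l.1)‖ ≤ b.1.length := by
  have h : ∀ᵐ Y ∂(annealedLaw Q x).restrict (noBacktrack d), ∀ n,
      ∃ (l : RecordWord d) (b : Block d),
      Y ∈ regenEvent x (l.1 ++ b.1) ∧ ‖Y n - (x + disp l.1)‖ ≤ b.1.length := by
    rw [ae_restrict_iff' measurableSet_noBacktrack]
    filter_upwards [annealedLaw_steps Q x, annealedLaw_start Q x, ae_exists_regeneration hT x]
      with Y h1 h2 h3 hD n
    have := exists_record_block_near h1 hD h3 n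
    rwa [h2] at this
  exact Measure.ae_smul_measure h _

/-- The probability that the conditioned walks intersect is at most the expected number of pairs of
blocks, one of each walk, that come close to each other. -/
theorem conditionedPairLaw_intersect_le (hT : ∀ᵐ Y ∂annealedLaw Q 0, Transient Y)
    (U₁ U₂ : Site d) : conditionedPairLaw Q U₁ U₂ (intersect d) ≤
      ∑' (b : Block d) (b' : Block d) (l : RecordWord d) (l' : RecordWord d),
        if ‖U₁ - U₂ + disp l.1 - disp l'.1‖ ≤ (b.1.length + b'.1.length : ℕ) then
          (wordWeight Q l.1 * wordWeight Q b.1) * (wordWeight Q l'.1 * wordWeight Q b'.1)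
        else 0 := by
  have hp := noBacktrackProb_ne_zero hT
  set μ₁ := cond (annealedLaw Q U₁) (noBacktrack d) with hμ₁
  set μ₂ := cond (annealedLaw Q U₂) (noBacktrack d) with hμ₂
  let E : Block d → Block d → RecordWord d → RecordWord d → Set (Traj d × Traj d) :=
    fun b b' l l' =>
      if ‖U₁ - U₂ + disp l.1 - disp l'.1‖ ≤ (b.1.length + b'.1.length : ℕ) then
        regenEvent U₁ (l.1 ++ b.1) ×ˢ regenEvent U₂ (l'.1 ++ b'.1) else ∅
  have hcover : ∀ᵐ Y ∂μ₁.prod μ₂, Y ∈ intersect d → Y ∈ ⋃ b, ⋃ b', ⋃ l, ⋃ l', E b b' l l' := by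
    filter_upwards [Measure.quasiMeasurePreserving_fst.ae (ae_cond_record_block hT U₁),
      Measure.quasiMeasurePreserving_snd.ae (ae_cond_record_block hT U₂)] with Y h1 h2 hY
    obtain ⟨m, n, hmn⟩ := hY
    obtain ⟨l, b, hE, hlb⟩ := h1 m
    obtain ⟨l', b', hE', hlb'⟩ := h2 n
    simp only [Set.mem_iUnion]
    refine ⟨b, b', l, l', ?_⟩
    have hle : ‖U₁ - U₂ + disp l.1 - disp l'.1‖ ≤ (b.1.length + b'.1.length : ℕ) := by
      have : U₁ - U₂ + disp l.1 - disp l'.1 =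
          (Y.2 n - (U₂ + disp l'.1)) - (Y.1 m - (U₁ + disp l.1)) := by rw [hmn]; abel
      rw [this]
      push_cast
      linarith [norm_sub_le (Y.2 n - (U₂ + disp l'.1)) (Y.1 m - (U₁ + disp l.1))]
    simp only [E, if_pos hle]
    exact ⟨hE, hE'⟩
  calc conditionedPairLaw Q U₁ U₂ (intersect d)
      ≤ μ₁.prod μ₂ (⋃ b, ⋃ b', ⋃ l, ⋃ l', E b b' l l') := measure_mono_ae hcover
    _ ≤ ∑' (b : Block d) (b' : Block d) (l : RecordWord d) (l' : RecordWord d),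
          μ₁.prod μ₂ (E b b' l l') := by
        refine (measure_iUnion_le _).trans (ENNReal.tsum_le_tsum fun b => ?_)
        refine (measure_iUnion_le _).trans (ENNReal.tsum_le_tsum fun b' => ?_)
        exact (measure_iUnion_le _).trans (ENNReal.tsum_le_tsum fun l => measure_iUnion_le _)
    _ ≤ _ := by
        refine ENNReal.tsum_le_tsum fun b => ENNReal.tsum_le_tsum fun b' =>
          ENNReal.tsum_le_tsum fun l => ENNReal.tsum_le_tsum fun l' => ?_
        simp only [E]
        split_ifs
        · rw [Measure.prod_prod]
          exact mul_le_mul' (cond_regenEvent hp U₁ l b) (cond_regenEvent hp U₂ l' b')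
        · simp

end Intersection

/-! ### Binomial estimates -/

section Binomial

theorem centralBinom_sq_mul_le (m : ℕ) : m.centralBinom ^ 2 * (2 * m + 1) ≤ 16 ^ m := by
  induction m with
  | zero => simp
  | succ m ih =>
    have h := Nat.succ_mul_centralBinom_succ m
    have h2 : (m + 1) ^ 2 * ((m + 1).centralBinom ^ 2 * (2 * (m + 1) + 1)) ≤
        (m + 1) ^ 2 * 16 ^ (m + 1) := by
      calc (m + 1) ^ 2 * ((m + 1).centralBinom ^ 2 * (2 * (m + 1) + 1))
          = ((m + 1) * (m + 1).centralBinom) ^ 2 * (2 * m + 3) := by ring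
        _ = (m.centralBinom ^ 2 * (2 * m + 1)) * (4 * ((2 * m + 1) * (2 * m + 3))) := by
            rw [h]; ring
        _ ≤ 16 ^ m * (4 * (4 * (m + 1) ^ 2)) :=
            Nat.mul_le_mul ih (Nat.mul_le_mul_left 4 (by nlinarith))
        _ = (m + 1) ^ 2 * 16 ^ (m + 1) := by ring
    exact Nat.le_of_mul_le_mul_left h2 (by positivity)

/-- Binomial coefficients are at most `2 ^ j / √(j + 1)`. -/
theorem choose_sq_mul_le (j k : ℕ) : j.choose k ^ 2 * (j + 1) ≤ 4 ^ j := by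
  have hmid : j.choose (j / 2) ^ 2 * (j + 1) ≤ 4 ^ j := by
    rcases Nat.even_or_odd' j with ⟨m, rfl | rfl⟩
    · have := centralBinom_sq_mul_le m
      rw [Nat.centralBinom_eq_two_mul_choose] at this
      rw [Nat.mul_div_cancel_left m two_pos, pow_mul]
      simpa using this
    · have h1 := centralBinom_sq_mul_le (m + 1)
      have h2 : (m + 1).centralBinom = 2 * (2 * m + 1).choose m := by
        rw [Nat.centralBinom_eq_two_mul_choose, show 2 * (m + 1) = (2 * m + 1) + 1 by ring,
          Nat.choose_succ_succ, Nat.choose_symm_half]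
        ring
      rw [h2] at h1
      have h3 : (2 * m + 1) / 2 = m := by omega
      rw [h3]
      have h4 : (4 : ℕ) ^ (2 * m + 1) * 4 = 16 ^ (m + 1) := by
        rw [← pow_succ, show 2 * m + 1 + 1 = 2 * (m + 1) by ring, pow_mul]
        norm_num
      nlinarith
  exact (Nat.mul_le_mul_right _ (Nat.pow_le_pow_left (Nat.choose_le_middle k j) 2)).trans hmid

theorem choose_le_rpow (j k : ℕ) :
    (j.choose k : ℝ) ≤ 2 ^ j * ((j : ℝ) + 1) ^ (-(1 / 2) : ℝ) := by
  have h : (j.choose k : ℝ) ^ 2 * (j + 1) ≤ 4 ^ j := by exact_mod_cast choose_sq_mul_le j k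
  have hj : (0 : ℝ) < (j : ℝ) + 1 := by positivity
  rw [Real.rpow_neg hj.le, ← Real.sqrt_eq_rpow, ← div_eq_mul_inv, le_div_iff₀ (Real.sqrt_pos.2 hj)]
  refine abs_le_of_sq_le_sq' ?_ (by positivity) |>.2
  rw [mul_pow, Real.sq_sqrt hj.le, ← pow_mul, mul_comm j 2, pow_mul]
  norm_num
  exact h

/-- The power `x ^ (-3/2)` is a supersolution of the recursion satisfied by the expected decay when
a good step occurs with probability `c`. -/
theorem rpow_neg_three_halves_step {c x : ℝ} (hc : 0 ≤ c) (hx : 1 ≤ x) :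
    c * (x + 1) ^ (-(3 / 2) : ℝ) + (1 - c) * x ^ (-(3 / 2) : ℝ) ≤
      (x + c / 4) ^ (-(3 / 2) : ℝ) := by
  have hx0 : 0 < x := by linarith
  have key : ∀ y, 0 ≤ y → (x + y) ^ (-(3 / 2) : ℝ) =
      x ^ (-(3 / 2) : ℝ) * (x / (x + y)) ^ (3 / 2 : ℝ) := fun y hy => by
    have hxy : 0 < x + y := by linarith
    rw [Real.div_rpow hx0.le hxy.le, Real.rpow_neg hx0.le, Real.rpow_neg hxy.le]
    have h1 : x ^ (3 / 2 : ℝ) ≠ 0 := (Real.rpow_pos_of_pos hx0 _).ne'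
    field_simp
  have hu : (x / (x + 1)) ^ (3 / 2 : ℝ) ≤ x / (x + 1) := by
    conv_rhs => rw [← Real.rpow_one (x / (x + 1))]
    refine Real.rpow_le_rpow_of_exponent_ge (by positivity) ?_ (by norm_num)
    rw [div_le_one (by linarith)]; linarith
  have hw : (x / (x + c / 4)) ^ 2 ≤ (x / (x + c / 4)) ^ (3 / 2 : ℝ) := by
    rw [← Real.rpow_natCast]
    refine Real.rpow_le_rpow_of_exponent_ge (by positivity) ?_ (by norm_num)
    rw [div_le_one (by linarith)]; linarith
  rw [key 1 zero_le_one, key (c / 4) (by linarith)]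
  have h2 : c * (x / (x + 1)) + (1 - c) ≤ (x / (x + c / 4)) ^ 2 := by
    have hxc : 0 < x + c / 4 := by linarith
    have e1 : x / (x + 1) = 1 - 1 / (x + 1) := by field_simp; ring
    have e2 : x / (x + c / 4) = 1 - (c / 4) / (x + c / 4) := by field_simp; ring
    have h3 : (c / 4) / (x + c / 4) ≤ (c / 4) / x :=
      div_le_div_of_nonneg_left (by linarith) hx0 (by linarith)
    have h4 : c / 2 / x ≤ c / (x + 1) := by
      rw [div_le_div_iff₀ hx0 (by linarith)]
      nlinarith
    have h5 : (c / 4) / x * 2 = c / 2 / x := by ring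
    have h6 : c * (1 / (x + 1)) = c / (x + 1) := by ring
    rw [e1, e2]
    nlinarith [sq_nonneg (c / 4 / (x + c / 4))]
  have hpos : 0 ≤ x ^ (-(3 / 2) : ℝ) := Real.rpow_nonneg hx0.le _
  calc c * (x ^ (-(3 / 2) : ℝ) * (x / (x + 1)) ^ (3 / 2 : ℝ)) + (1 - c) * x ^ (-(3 / 2) : ℝ)
      = x ^ (-(3 / 2) : ℝ) * (c * (x / (x + 1)) ^ (3 / 2 : ℝ) + (1 - c)) := by ring
    _ ≤ x ^ (-(3 / 2) : ℝ) * (x / (x + c / 4)) ^ (3 / 2 : ℝ) := by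
        refine mul_le_mul_of_nonneg_left ?_ hpos
        nlinarith

end Binomial

/-! ### Convolution operators and renewal functions -/

section Operators

variable {d : ℕ}

/-- Convolution with `μ`, as an operator on functions on the lattice. -/
def convOp (μ : Site d → ℝ≥0∞) : Module.End ℝ≥0∞ (Site d → ℝ≥0∞) where
  toFun h z := ∑' y, μ y * h (z - y)
  map_add' h h' := by
    funext z
    simp only [Pi.add_apply, mul_add]
    exact ENNReal.tsum_add
  map_smul' c h := by
    funext z
    simp only [Pi.smul_apply, smul_eq_mul, RingHom.id_apply, ← ENNReal.tsum_mul_left]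
    exact tsum_congr fun y => by ring

theorem convOp_apply (μ h : Site d → ℝ≥0∞) (z : Site d) :
    convOp μ h z = ∑' y, μ y * h (z - y) := rfl

/-- Translation by `v`, as an operator on functions on the lattice. -/
def transOp (v : Site d) : Module.End ℝ≥0∞ (Site d → ℝ≥0∞) where
  toFun h z := h (z - v)
  map_add' _ _ := rfl
  map_smul' _ _ := rfl

theorem transOp_apply (v : Site d) (h : Site d → ℝ≥0∞) (z : Site d) :
    transOp v h z = h (z - v) := rfl

theorem transOp_mul (v w : Site d) : transOp v * transOp w = transOp (v + w) := by
  refine LinearMap.ext fun h => funext fun z => ?_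
  simp [transOp_apply, sub_sub]

theorem transOp_pow (v : Site d) (k : ℕ) : transOp v ^ k = transOp (k • v) := by
  induction k with
  | zero => refine LinearMap.ext fun h => funext fun z => ?_; simp [transOp_apply]
  | succ k ih => rw [pow_succ, ih, transOp_mul, succ_nsmul]

theorem commute_transOp (v w : Site d) : Commute (transOp v) (transOp w) := by
  rw [Commute, SemiconjBy, transOp_mul, transOp_mul, add_comm]

theorem commute_convOp_transOp (μ : Site d → ℝ≥0∞) (v : Site d) :
    Commute (convOp μ) (transOp v) := by
  refine LinearMap.ext fun h => funext fun z => ?_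
  simp only [Module.End.mul_apply, convOp_apply, transOp_apply]
  exact tsum_congr fun y => by rw [sub_right_comm]

theorem one_add_transOp_pow_apply (v : Site d) (j : ℕ) (h : Site d → ℝ≥0∞) (z : Site d) :
    ((1 + transOp v) ^ j) h z = ∑ k ∈ Finset.range (j + 1), (j.choose k : ℝ≥0∞) * h (z - k • v) := by
  rw [add_comm, (Commute.one_right (transOp v)).add_pow]
  simp only [one_pow, mul_one, LinearMap.sum_apply, Finset.sum_apply, Module.End.mul_apply,
    transOp_pow]
  refine Finset.sum_congr rfl fun k _ => ?_
  rw [Module.End.natCast_apply, transOp_apply, Pi.smul_apply, nsmul_eq_mul]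

theorem one_add_transOp_pow_le (v : Site d) (j : ℕ) (h : Site d → ℝ≥0∞) (z : Site d) :
    ((1 + transOp v) ^ j) h z ≤
      ENNReal.ofReal (2 ^ j * ((j : ℝ) + 1) ^ (-(1 / 2) : ℝ)) * ∑' k : ℕ, h (z - k • v) := by
  rw [one_add_transOp_pow_apply]
  calc ∑ k ∈ Finset.range (j + 1), (j.choose k : ℝ≥0∞) * h (z - k • v)
      ≤ ∑ k ∈ Finset.range (j + 1),
          ENNReal.ofReal (2 ^ j * ((j : ℝ) + 1) ^ (-(1 / 2) : ℝ)) * h (z - k • v) := by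
        refine Finset.sum_le_sum fun k _ => mul_le_mul' ?_ le_rfl
        rw [← ENNReal.ofReal_natCast]
        exact ENNReal.ofReal_le_ofReal (choose_le_rpow j k)
    _ = ENNReal.ofReal (2 ^ j * ((j : ℝ) + 1) ^ (-(1 / 2) : ℝ)) *
          ∑ k ∈ Finset.range (j + 1), h (z - k • v) := by rw [Finset.mul_sum]
    _ ≤ _ := mul_le_mul' le_rfl (ENNReal.sum_le_tsum (f := fun k : ℕ => h (z - k • v)) _)

/-- A renewal function far from the origin needs either a large jump among the first `n` or more
than `n` jumps. -/
theorem renewal_le_tail_add {μ g : Site d → ℝ≥0∞} (hμ : ∑' y, μ y ≤ 1) (hg1 : ∀ z, g z ≤ 1)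
    (hg : ∀ z, g z ≤ (if z = 0 then 1 else 0) + convOp μ g z) {a : ℕ} (ha : 0 < a) (n : ℕ)
    (z : Site d) (hz : (n * a : ℕ) ≤ ‖z‖) :
    g z ≤ n * (∑' y, if (a : ℝ) ≤ ‖y‖ then μ y else 0) + (convOp μ ^ n) g z := by
  induction n generalizing z with
  | zero => simp
  | succ n ih =>
    set F := ∑' y, if (a : ℝ) ≤ ‖y‖ then μ y else 0 with hF
    have ha' : (1 : ℝ) ≤ a := by exact_mod_cast ha
    have hz0 : z ≠ 0 := by
      rintro rfl
      rw [norm_zero] at hz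
      have : (0 : ℝ) < ((n + 1) * a : ℕ) := by exact_mod_cast Nat.mul_pos n.succ_pos ha
      linarith
    calc g z ≤ ∑' y, μ y * g (z - y) := by
          simpa [hz0, convOp_apply] using hg z
      _ ≤ ∑' y, ((if (a : ℝ) ≤ ‖y‖ then μ y else 0) +
            (μ y * (n * F) + μ y * ((convOp μ ^ n) g (z - y)))) := by
          refine ENNReal.tsum_le_tsum fun y => ?_
          split_ifs with h
          · refine le_trans ?_ le_self_add
            calc μ y * g (z - y) ≤ μ y * 1 := mul_le_mul' le_rfl (hg1 _)
              _ = μ y := mul_one _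
          · rw [zero_add, ← mul_add]
            refine mul_le_mul' le_rfl (ih _ ?_)
            have h1 := norm_sub_norm_le z y
            push_cast at hz ⊢
            push Not at h
            linarith
      _ = F + ((∑' y, μ y) * (n * F) + ∑' y, μ y * ((convOp μ ^ n) g (z - y))) := by
          rw [ENNReal.tsum_add, ENNReal.tsum_add, ENNReal.tsum_mul_right]
      _ ≤ F + (1 * (n * F) + ∑' y, μ y * ((convOp μ ^ n) g (z - y))) := by gcongr
      _ = ((n + 1 : ℕ) : ℝ≥0∞) * F + (convOp μ ^ (n + 1)) g z := by
          rw [pow_succ', Module.End.mul_apply, convOp_apply]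
          push_cast
          ring

variable [NeZero d]

/-- The function `h` has total mass at most `s` on every level. -/
def LevelBounded (h : Site d → ℝ≥0∞) (s : ℝ≥0∞) : Prop :=
  ∀ ℓ : ℤ, ∑' z : Site d, (if z 0 = ℓ then h z else 0) ≤ s

theorem LevelBounded.apply_le {h : Site d → ℝ≥0∞} {s : ℝ≥0∞} (hs : LevelBounded h s)
    (z : Site d) : h z ≤ s := by
  refine le_trans ?_ (hs (z 0))
  simpa using ENNReal.le_tsum (f := fun y : Site d => if y 0 = z 0 then h y else 0) z

theorem LevelBounded.translate {h : Site d → ℝ≥0∞} {s : ℝ≥0∞} (hs : LevelBounded h s)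
    (v : Site d) : LevelBounded (fun z => h (z + v)) s := fun ℓ => by
  refine le_of_eq_of_le ?_ (hs (ℓ + v 0))
  rw [← (Equiv.addRight v).tsum_eq (fun z : Site d => if z 0 = ℓ + v 0 then h z else 0)]
  exact tsum_congr fun z => by simp

theorem LevelBounded.convOp {h ρ : Site d → ℝ≥0∞} {s m : ℝ≥0∞} (hs : LevelBounded h s)
    (hρ : ∑' y, ρ y ≤ m) : LevelBounded (convOp ρ h) (m * s) := fun ℓ => by
  calc ∑' z : Site d, (if z 0 = ℓ then RWRE.convOp ρ h z else 0)
      = ∑' (z : Site d) (y : Site d), ρ y * (if z 0 = ℓ then h (z + -y) else 0) := by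
        refine tsum_congr fun z => ?_
        split_ifs <;> simp [convOp_apply, sub_eq_add_neg]
    _ = ∑' y : Site d, ρ y * ∑' z : Site d, (if z 0 = ℓ then h (z + -y) else 0) := by
        rw [ENNReal.tsum_comm]
        exact tsum_congr fun y => ENNReal.tsum_mul_left
    _ ≤ ∑' y : Site d, ρ y * s :=
        ENNReal.tsum_le_tsum fun y => mul_le_mul' le_rfl (hs.translate (-y) ℓ)
    _ ≤ m * s := by
        rw [ENNReal.tsum_mul_right]
        exact mul_le_mul' hρ le_rfl

/-- Each convolution with a law on positive levels raises the support by one level. -/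
theorem convOp_pow_eq_zero {μ g : Site d → ℝ≥0∞} (hμ : ∀ y, μ y ≠ 0 → 1 ≤ y 0)
    (hg : ∀ y, g y ≠ 0 → 0 ≤ y 0) (n : ℕ) (z : Site d) (hz : z 0 < n) :
    (convOp μ ^ n) g z = 0 := by
  induction n generalizing z with
  | zero =>
    by_contra h
    have := hg z (by simpa using h)
    simp at hz
    omega
  | succ n ih =>
    rw [pow_succ', Module.End.mul_apply, convOp_apply, ENNReal.tsum_eq_zero]
    intro y
    by_cases hy : μ y = 0
    · rw [hy, zero_mul]
    · rw [ih, mul_zero]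
      have := hμ y hy
      push_cast at hz
      rw [Pi.sub_apply]
      omega

end Operators

/-! ### Decay of the convolution powers in dimension four -/

section FourDimensional

/-- The sum of the translations by `e_1 + ε`, where `ε` ranges over the vertices of the unit cube
spanned by `e_2, e_3, e_4`. -/
def cubeOp : Module.End ℝ≥0∞ (Site 4 → ℝ≥0∞) :=
  transOp (Pi.single 0 1) * ((1 + transOp (Pi.single 1 1)) *
    ((1 + transOp (Pi.single 2 1)) * (1 + transOp (Pi.single 3 1))))

theorem cubeOp_pow (j : ℕ) : cubeOp ^ j =
    transOp (Pi.single 0 1) ^ j * ((1 + transOp (Pi.single 1 1)) ^ j *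
      ((1 + transOp (Pi.single 2 1)) ^ j * (1 + transOp (Pi.single 3 1)) ^ j)) := by
  have h : ∀ v w : Site 4, Commute (transOp v) (1 + transOp w) := fun v w =>
    (Commute.one_right _).add_right (commute_transOp v w)
  have h' : ∀ v w : Site 4, Commute (1 + transOp v) (1 + transOp w) := fun v w =>
    (Commute.one_left _).add_left (h v w)
  rw [cubeOp, Commute.mul_pow ((h _ _).mul_right ((h _ _).mul_right (h _ _))),
    Commute.mul_pow ((h' _ _).mul_right (h' _ _)), Commute.mul_pow (h' _ _)]

theorem commute_convOp_cubeOp (μ : Site 4 → ℝ≥0∞) : Commute (convOp μ) cubeOp := by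
  have h : ∀ w : Site 4, Commute (convOp μ) (1 + transOp w) := fun w =>
    (Commute.one_right _).add_right (commute_convOp_transOp μ w)
  exact (commute_convOp_transOp μ _).mul_right ((h _).mul_right ((h _).mul_right (h _)))

theorem cubeOp_apply (h : Site 4 → ℝ≥0∞) (z : Site 4) :
    cubeOp h z = ∑ s ∈ ({1, 2, 3} : Finset (Fin 4)).powerset, h (z - elementaryDisp s) := by
  have h3 : ({3} : Finset (Fin 4)).powerset = {∅, {3}} := by decide
  rw [Finset.sum_powerset_insert (by decide), Finset.sum_powerset_insert (by decide),
    Finset.sum_powerset_insert (by decide), h3]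
  simp [cubeOp, transOp_apply, elementaryDisp]
  ring_nf

/-- The transversal displacement after `j` good steps has three independent binomial coordinates, so
every value has probability at most `(j + 1) ^ (-3/2)`. -/
theorem cubeOp_pow_le {h : Site 4 → ℝ≥0∞} {s : ℝ≥0∞} (hs : LevelBounded h s) (j : ℕ)
    (z : Site 4) :
    (cubeOp ^ j) h z ≤ s * ENNReal.ofReal (8 ^ j * ((j : ℝ) + 1) ^ (-(3 / 2) : ℝ)) := by
  set β := ENNReal.ofReal (2 ^ j * ((j : ℝ) + 1) ^ (-(1 / 2) : ℝ)) with hβ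
  have hβ3 : β ^ 3 = ENNReal.ofReal (8 ^ j * ((j : ℝ) + 1) ^ (-(3 / 2) : ℝ)) := by
    rw [hβ, ← ENNReal.ofReal_pow (by positivity), mul_pow, ← pow_mul, mul_comm j 3, pow_mul,
      ← Real.rpow_natCast (((j : ℝ) + 1) ^ (-(1 / 2) : ℝ)) 3, ← Real.rpow_mul (by positivity)]
    norm_num
  rw [cubeOp_pow, transOp_pow]
  simp only [Module.End.mul_apply, transOp_apply]
  set y := z - j • (Pi.single 0 1 : Site 4)
  let φ : ℕ × ℕ × ℕ → Site 4 := fun p =>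
    y - p.1 • Pi.single 1 1 - p.2.1 • Pi.single 2 1 - p.2.2 • Pi.single 3 1
  have hφ : Function.Injective φ := by
    rintro ⟨a, b, c⟩ ⟨a', b', c'⟩ hp
    have h1 := congrFun hp 1
    have h2 := congrFun hp 2
    have h3 := congrFun hp 3
    simp [φ] at h1 h2 h3
    simp [h1, h2, h3]
  have hφ0 : ∀ p, φ p 0 = y 0 := fun p => by simp [φ]
  calc ((1 + transOp (Pi.single 1 1)) ^ j) (((1 + transOp (Pi.single 2 1)) ^ j)
        (((1 + transOp (Pi.single 3 1)) ^ j) h)) y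
      ≤ β * ∑' a : ℕ, (β * ∑' b : ℕ, (β * ∑' c : ℕ, h (φ (a, b, c)))) := by
        refine (one_add_transOp_pow_le _ j _ _).trans (mul_le_mul' le_rfl ?_)
        refine ENNReal.tsum_le_tsum fun a => ?_
        refine (one_add_transOp_pow_le _ j _ _).trans (mul_le_mul' le_rfl ?_)
        exact ENNReal.tsum_le_tsum fun b => one_add_transOp_pow_le _ j _ _
    _ = β ^ 3 * ∑' p : ℕ × ℕ × ℕ, h (φ p) := by
        simp only [ENNReal.tsum_mul_left]
        rw [ENNReal.tsum_prod (f := fun a (q : ℕ × ℕ) => h (φ (a, q)))]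
        simp_rw [fun a => ENNReal.tsum_prod (f := fun b c => h (φ (a, b, c)))]
        ring
    _ ≤ β ^ 3 * s := by
        refine mul_le_mul' le_rfl (le_trans ?_ (hs (y 0)))
        calc ∑' p, h (φ p) = ∑' p, if φ p 0 = y 0 then h (φ p) else 0 := by simp [hφ0]
          _ ≤ _ := ENNReal.tsum_comp_le_tsum_of_injective hφ
              (fun z : Site 4 => if z 0 = y 0 then h z else 0)
    _ = _ := by rw [hβ3, mul_comm]

/-- A law that charges the eight elementary displacements splits off a multiple of `cubeOp`. -/
theorem exists_convOp_eq_add {μ : Site 4 → ℝ≥0∞} {k : ℝ≥0∞}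
    (hk : ∀ s ∈ ({1, 2, 3} : Finset (Fin 4)).powerset, k ≤ μ (elementaryDisp s)) :
    ∃ ρ : Site 4 → ℝ≥0∞, convOp μ = k • cubeOp + convOp ρ ∧ ∑' y, μ y = 8 * k + ∑' y, ρ y := by
  set P := ({1, 2, 3} : Finset (Fin 4)).powerset with hP
  have hinj : Set.InjOn (elementaryDisp (d := 4)) P := by
    intro s hs t ht hst
    have h0 : ∀ u ∈ P, ∀ i : Fin 4, i ≠ 0 → (elementaryDisp u i = if i ∈ u then 1 else 0) := by
      intro u _ i hi
      simp [elementaryDisp, hi, Finset.sum_apply, Pi.single_apply]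
    ext i
    by_cases hi : i = 0
    · subst hi
      have : ∀ u ∈ P, (0 : Fin 4) ∉ u := by decide
      simp [this s hs, this t ht]
    · have h := congrFun hst i
      rw [h0 s hs i hi, h0 t ht i hi] at h
      by_cases h1 : i ∈ s <;> by_cases h2 : i ∈ t <;> simp_all
  set S : Finset (Site 4) := P.image elementaryDisp with hS
  have hkS : ∀ y ∈ S, k ≤ μ y := fun y hy => by
    obtain ⟨s, hs, rfl⟩ := Finset.mem_image.1 hy
    exact hk s hs
  let ν : Site 4 → ℝ≥0∞ := fun y => if y ∈ S then k else 0
  have hν : ∀ y, ν y + (μ y - ν y) = μ y := fun y => add_tsub_cancel_of_le (by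
    simp only [ν]
    split_ifs with h
    · exact hkS y h
    · exact zero_le)
  have hsum : ∀ f : Site 4 → ℝ≥0∞, ∑' y, ν y * f y = k * ∑ s ∈ P, f (elementaryDisp s) :=
    fun f => by
      rw [tsum_eq_sum (s := S) fun y hy => by simp [ν, hy],
        Finset.sum_image (fun a ha b hb h => hinj ha hb h), Finset.mul_sum]
      refine Finset.sum_congr rfl fun s hs => ?_
      have : elementaryDisp s ∈ S := Finset.mem_image_of_mem _ hs
      simp [ν, this]
  refine ⟨fun y => μ y - ν y, ?_, ?_⟩
  · refine LinearMap.ext fun h => funext fun z => ?_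
    rw [LinearMap.add_apply, LinearMap.smul_apply, Pi.add_apply, Pi.smul_apply, smul_eq_mul,
      cubeOp_apply, convOp_apply, convOp_apply, ← hsum fun y => h (z - y), ← ENNReal.tsum_add]
    exact tsum_congr fun y => by rw [← add_mul, hν]
  · have h8 : ∑' y, ν y = 8 * k := by
      have := hsum fun _ => 1
      simp only [mul_one, Finset.sum_const, nsmul_eq_mul] at this
      rw [this, show P.card = 8 by decide, mul_comm]
      norm_num
    rw [← h8, ← ENNReal.tsum_add]
    exact tsum_congr fun y => (hν y).symm

/-- Decay of the convolution powers of a law that charges the eight elementary displacements,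
applied to a function with bounded mass on the levels. -/
theorem convOp_pow_cubeOp_pow_le {μ : Site 4 → ℝ≥0∞} {k : ℝ} (hk0 : 0 ≤ k) (hμ : ∑' y, μ y ≤ 1)
    (hk : ∀ s ∈ ({1, 2, 3} : Finset (Fin 4)).powerset,
      ENNReal.ofReal k ≤ μ (elementaryDisp s)) (n j : ℕ)
    {h : Site 4 → ℝ≥0∞} {s : ℝ≥0∞} (hs : LevelBounded h s) (z : Site 4) :
    (convOp μ ^ n) ((cubeOp ^ j) h) z ≤
      s * ENNReal.ofReal (8 ^ j * ((j : ℝ) + 1 + n * (2 * k)) ^ (-(3 / 2) : ℝ)) := by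
  obtain ⟨ρ, hρ, hsum⟩ := exists_convOp_eq_add hk
  rw [hsum] at hμ
  have hk8 : 8 * k ≤ 1 := by
    have h1 : 8 * ENNReal.ofReal k ≤ 1 := le_self_add.trans hμ
    have h2 : ENNReal.ofReal (8 * k) ≤ 1 := by
      rw [ENNReal.ofReal_mul (by norm_num)]
      simpa using h1
    exact ENNReal.ofReal_le_one.1 h2
  have hρ1 : ∑' y, ρ y ≤ ENNReal.ofReal (1 - 8 * k) := by
    rw [ENNReal.ofReal_sub _ (by positivity), ENNReal.ofReal_one,
      ENNReal.ofReal_mul (by norm_num)]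
    refine ENNReal.le_sub_of_add_le_left (by finiteness) ?_
    simpa using hμ
  induction n generalizing j h s z with
  | zero => simpa using cubeOp_pow_le hs j z
  | succ n ih =>
    set x : ℝ := (j : ℝ) + 1 + n * (2 * k) with hx
    have hx1 : 1 ≤ x := by
      have : 0 ≤ (j : ℝ) + n * (2 * k) := by positivity
      linarith
    have e1 : (convOp μ ^ (n + 1)) ((cubeOp ^ j) h) z =
        ENNReal.ofReal k * (convOp μ ^ n) ((cubeOp ^ (j + 1)) h) z +
          (convOp μ ^ n) ((cubeOp ^ j) (convOp ρ h)) z := by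
      have hc : convOp ρ ((cubeOp ^ j) h) = (cubeOp ^ j) (convOp ρ h) := by
        have := (commute_convOp_cubeOp ρ).pow_right j
        exact LinearMap.congr_fun this h
      rw [pow_succ, Module.End.mul_apply]
      conv_lhs => rw [show convOp μ ((cubeOp ^ j) h) =
        ENNReal.ofReal k • (cubeOp ^ (j + 1)) h + (cubeOp ^ j) (convOp ρ h) by
          rw [hρ, LinearMap.add_apply, LinearMap.smul_apply, hc, pow_succ', Module.End.mul_apply]]
      rw [map_add, map_smul]
      rfl
    have i1 := ih (j + 1) hs z
    have i2 := ih j (hs.convOp hρ1) z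
    have hstep := rpow_neg_three_halves_step (c := 8 * k) (by positivity) hx1
    have ex1 : ((j + 1 : ℕ) : ℝ) + 1 + n * (2 * k) = x + 1 := by push_cast; ring
    have ex2 : (j : ℝ) + 1 + (n + 1 : ℕ) * (2 * k) = x + 8 * k / 4 := by push_cast; ring
    rw [ex1] at i1
    rw [e1, ex2]
    have hx0 : 0 ≤ x := by linarith
    calc ENNReal.ofReal k * (convOp μ ^ n) ((cubeOp ^ (j + 1)) h) z +
          (convOp μ ^ n) ((cubeOp ^ j) (convOp ρ h)) z
        ≤ ENNReal.ofReal k * (s * ENNReal.ofReal (8 ^ (j + 1) * (x + 1) ^ (-(3 / 2) : ℝ))) +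
          ENNReal.ofReal (1 - 8 * k) * s * ENNReal.ofReal (8 ^ j * x ^ (-(3 / 2) : ℝ)) :=
          add_le_add (mul_le_mul' le_rfl i1) i2
      _ = s * (ENNReal.ofReal k * ENNReal.ofReal (8 ^ (j + 1) * (x + 1) ^ (-(3 / 2) : ℝ)) +
          ENNReal.ofReal (1 - 8 * k) * ENNReal.ofReal (8 ^ j * x ^ (-(3 / 2) : ℝ))) := by ring
      _ = s * ENNReal.ofReal (8 ^ j * (8 * k * (x + 1) ^ (-(3 / 2) : ℝ) +
          (1 - 8 * k) * x ^ (-(3 / 2) : ℝ))) := by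
          rw [← ENNReal.ofReal_mul hk0, ← ENNReal.ofReal_mul (by linarith),
            ← ENNReal.ofReal_add (by positivity)
              (mul_nonneg (by linarith) (by positivity))]
          congr 2
          ring
      _ ≤ _ := by gcongr

end FourDimensional

/-! ### Pointwise decay of the renewal function -/

section Green

/-- The properties of the law `μ` of a renewal displacement and of its renewal function `g` on which
the decay of `g` depends: `μ` moves upwards, charges the elementary displacements and has eighth
moments, and `g` satisfies the renewal inequality. -/
structure IsRenewalPair (μ g : Site 4 → ℝ≥0∞) (k M : ℝ) : Prop where
  mass_le : ∑' y, μ y ≤ 1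
  level_pos : ∀ y, μ y ≠ 0 → 1 ≤ y 0
  le_elementary : ∀ s ∈ ({1, 2, 3} : Finset (Fin 4)).powerset,
    ENNReal.ofReal k ≤ μ (elementaryDisp s)
  tail_le : ∀ a : ℕ, 0 < a →
    ∑' y, (if (a : ℝ) ≤ ‖y‖ then μ y else 0) ≤ ENNReal.ofReal (M / (a : ℝ) ^ 8)
  renewal_le : ∀ z, g z ≤ (if z = 0 then 1 else 0) + convOp μ g z
  levelBounded : LevelBounded g 1
  level_nonneg : ∀ y, g y ≠ 0 → 0 ≤ y 0

variable {μ g : Site 4 → ℝ≥0∞} {k M : ℝ}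

theorem natCast_le_norm {z : Site 4} {ℓ : ℕ} (hz : z 0 = ℓ) : (ℓ : ℝ) ≤ ‖z‖ := by
  have := norm_le_pi_norm z 0
  rw [hz] at this
  simpa using this

/-- At height `ℓ` the renewal function is `O(ℓ ^ (-9/8))`. With `K ≈ ℓ ^ (1/4)`, either one of the
first `K ^ 3` jumps exceeds `K`, or the `K ^ 3` jumps spread the transversal position. -/
theorem IsRenewalPair.le_rpow_level (h : IsRenewalPair μ g k M) (hk : 0 < k) (hM : 0 ≤ M)
    {z : Site 4} {ℓ : ℕ} (hz : z 0 = ℓ) :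
    g z ≤ ENNReal.ofReal ((1 + 32 ^ (9 / 8 : ℝ) * (M + (2 * k) ^ (-(3 / 2) : ℝ))) *
      (1 + (ℓ : ℝ)) ^ (-(9 / 8) : ℝ)) := by
  set A : ℝ := M + (2 * k) ^ (-(3 / 2) : ℝ) with hA
  have hA0 : 0 ≤ A := by positivity
  rcases Nat.eq_zero_or_pos ℓ with rfl | hℓ
  · refine (h.levelBounded.apply_le z).trans ?_
    rw [← ENNReal.ofReal_one]
    refine ENNReal.ofReal_le_ofReal ?_
    have : 0 ≤ 32 ^ (9 / 8 : ℝ) * A := by positivity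
    simpa using this
  -- `K` is the integer part of `ℓ ^ (1/4)`.
  obtain ⟨K, hK0, hKle, hKlt⟩ : ∃ K : ℕ, 0 < K ∧ K ^ 4 ≤ ℓ ∧ ℓ < (K + 1) ^ 4 := by
    refine ⟨ℓ.sqrt.sqrt, Nat.sqrt_pos.2 (Nat.sqrt_pos.2 hℓ), ?_, ?_⟩
    · calc ℓ.sqrt.sqrt ^ 4 = (ℓ.sqrt.sqrt ^ 2) ^ 2 := by ring
        _ ≤ ℓ.sqrt ^ 2 := Nat.pow_le_pow_left (Nat.sqrt_le' _) 2
        _ ≤ ℓ := Nat.sqrt_le' _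
    · calc ℓ < (ℓ.sqrt + 1) ^ 2 := Nat.lt_succ_sqrt' ℓ
        _ ≤ ((ℓ.sqrt.sqrt + 1) ^ 2) ^ 2 := Nat.pow_le_pow_left (Nat.lt_succ_sqrt' ℓ.sqrt) 2
        _ = (ℓ.sqrt.sqrt + 1) ^ 4 := by ring
  have hKr : (1 : ℝ) ≤ K := by exact_mod_cast hK0
  have hX : 1 + (ℓ : ℝ) ≤ 32 * (K : ℝ) ^ 4 := by
    have h1 : ((ℓ + 1 : ℕ) : ℝ) ≤ ((K + 1 : ℕ) : ℝ) ^ 4 := by exact_mod_cast hKlt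
    push_cast at h1
    have h2 : ((K : ℝ) + 1) ^ 4 ≤ (2 * K) ^ 4 := pow_le_pow_left₀ (by positivity) (by linarith) 4
    have h3 : (2 * (K : ℝ)) ^ 4 = 16 * (K : ℝ) ^ 4 := by ring
    have h4 : 0 ≤ (K : ℝ) ^ 4 := by positivity
    linarith
  have hpow : (K : ℝ) ^ (-(9 / 2) : ℝ) ≤ 32 ^ (9 / 8 : ℝ) * (1 + (ℓ : ℝ)) ^ (-(9 / 8) : ℝ) := by
    have h1 : ((K : ℝ) ^ 4) ^ (-(9 / 8) : ℝ) ≤ ((1 + (ℓ : ℝ)) / 32) ^ (-(9 / 8) : ℝ) :=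
      Real.rpow_le_rpow_of_nonpos (by positivity) (by linarith) (by norm_num)
    rw [Real.div_rpow (by positivity) (by norm_num), Real.rpow_neg (x := 32) (by norm_num),
      div_inv_eq_mul, ← Real.rpow_natCast, ← Real.rpow_mul (by positivity)] at h1
    norm_num at h1 ⊢
    linarith
  have h1 : g z ≤ ENNReal.ofReal (M / (K : ℝ) ^ 5) +
      ENNReal.ofReal ((1 + (K ^ 3 : ℕ) * (2 * k)) ^ (-(3 / 2) : ℝ)) := by
    refine (renewal_le_tail_add h.mass_le h.levelBounded.apply_le h.renewal_le hK0 (K ^ 3) z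
      ?_).trans (add_le_add ?_ ?_)
    · refine le_trans ?_ (natCast_le_norm hz)
      exact_mod_cast (show K ^ 3 * K ≤ ℓ by rw [← pow_succ]; exact hKle)
    · refine (mul_le_mul' le_rfl (h.tail_le K hK0)).trans_eq ?_
      rw [← ENNReal.ofReal_natCast, ← ENNReal.ofReal_mul (by positivity)]
      congr 1
      push_cast
      field_simp
    · have := convOp_pow_cubeOp_pow_le hk.le h.mass_le h.le_elementary (K ^ 3) 0 h.levelBounded z
      simpa using this
  refine h1.trans ?_
  rw [← ENNReal.ofReal_add (by positivity) (by positivity)]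
  refine ENNReal.ofReal_le_ofReal ?_
  have h2 : M / (K : ℝ) ^ 5 ≤ M * (K : ℝ) ^ (-(9 / 2) : ℝ) := by
    rw [div_eq_mul_inv, ← Real.rpow_natCast, ← Real.rpow_neg (by positivity)]
    refine mul_le_mul_of_nonneg_left (Real.rpow_le_rpow_of_exponent_le hKr (by norm_num)) hM
  have h3 : (1 + (K ^ 3 : ℕ) * (2 * k)) ^ (-(3 / 2) : ℝ) ≤
      (2 * k) ^ (-(3 / 2) : ℝ) * (K : ℝ) ^ (-(9 / 2) : ℝ) := by
    have e : (2 * k) ^ (-(3 / 2) : ℝ) * (K : ℝ) ^ (-(9 / 2) : ℝ) =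
        (2 * k * (K : ℝ) ^ 3) ^ (-(3 / 2) : ℝ) := by
      rw [Real.mul_rpow (x := 2 * k) (y := (K : ℝ) ^ 3) (by positivity) (by positivity),
        ← Real.rpow_natCast (K : ℝ) 3,
        ← Real.rpow_mul (by positivity)]
      norm_num
    rw [e]
    refine Real.rpow_le_rpow_of_nonpos (by positivity) ?_ (by norm_num)
    push_cast
    linarith
  have h4 : 0 ≤ (1 + (ℓ : ℝ)) ^ (-(9 / 8) : ℝ) := by positivity
  calc M / (K : ℝ) ^ 5 + (1 + (K ^ 3 : ℕ) * (2 * k)) ^ (-(3 / 2) : ℝ)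
      ≤ A * (K : ℝ) ^ (-(9 / 2) : ℝ) := by rw [hA, add_mul]; exact add_le_add h2 h3
    _ ≤ A * (32 ^ (9 / 8 : ℝ) * (1 + (ℓ : ℝ)) ^ (-(9 / 8) : ℝ)) :=
        mul_le_mul_of_nonneg_left hpow hA0
    _ ≤ _ := by linarith

/-- A point of height `ℓ` that is much farther than `ℓ` from the origin can be reached only with a
large jump. -/
theorem IsRenewalPair.le_norm (h : IsRenewalPair μ g k M) (hM : 0 ≤ M) {z : Site 4} {ℓ : ℕ}
    (hz : z 0 = ℓ) (hzX : 1 + (ℓ : ℝ) ≤ ‖z‖) :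
    g z ≤ ENNReal.ofReal ((1 + (ℓ : ℝ)) * (M * (2 * (1 + (ℓ : ℝ)) / ‖z‖) ^ 8)) := by
  set X : ℝ := 1 + (ℓ : ℝ) with hX
  have hX0 : 0 < X := by positivity
  have hz0 : 0 < ‖z‖ := hX0.trans_le hzX
  set a := ⌊‖z‖ / X⌋₊ with ha
  have hone : 1 ≤ ‖z‖ / X := (one_le_div hX0).2 hzX
  have ha0 : 0 < a := Nat.floor_pos.2 hone
  have har : (1 : ℝ) ≤ a := by exact_mod_cast ha0
  have hale : (a : ℝ) ≤ ‖z‖ / X := Nat.floor_le (by positivity)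
  have halt : ‖z‖ / X < a + 1 := Nat.lt_floor_add_one _
  have hr := renewal_le_tail_add h.mass_le h.levelBounded.apply_le h.renewal_le ha0 (ℓ + 1) z (by
    rw [le_div_iff₀ hX0] at hale
    push_cast
    linarith)
  rw [convOp_pow_eq_zero h.level_pos h.level_nonneg (ℓ + 1) z (by rw [hz]; push_cast; omega),
    add_zero] at hr
  refine (hr.trans (mul_le_mul' le_rfl (h.tail_le a ha0))).trans ?_
  rw [← ENNReal.ofReal_natCast, ← ENNReal.ofReal_mul (by positivity)]
  refine ENNReal.ofReal_le_ofReal ?_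
  have e : ((ℓ + 1 : ℕ) : ℝ) = X := by rw [hX]; push_cast; ring
  rw [e]
  refine mul_le_mul_of_nonneg_left ?_ hX0.le
  rw [div_eq_mul_inv, ← inv_pow]
  refine mul_le_mul_of_nonneg_left (pow_le_pow_left₀ (by positivity) ?_ 8) hM
  rw [inv_le_comm₀ (by positivity) (by positivity), inv_div]
  have : ‖z‖ / (2 * X) = ‖z‖ / X / 2 := by field_simp
  linarith

/-- The constant in the decay of the renewal function. -/
def decayConst (k M : ℝ) : ℝ :=
  2 * (1 + 32 ^ (9 / 8 : ℝ) * (M + (2 * k) ^ (-(3 / 2) : ℝ))) + 512 * M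

/-- The renewal function decays in the height and in the distance from the origin, in a way that is
summable over the levels. -/
theorem IsRenewalPair.decay (h : IsRenewalPair μ g k M) (hk : 0 < k) (hM : 0 ≤ M) {z : Site 4}
    {ℓ : ℕ} (hz : z 0 = ℓ) :
    ENNReal.ofReal ((1 + ‖z‖) ^ (1 / 48 : ℝ)) * g z ≤
      ENNReal.ofReal (decayConst k M * (1 + (ℓ : ℝ)) ^ (-(17 / 16) : ℝ)) := by
  set X : ℝ := 1 + (ℓ : ℝ) with hX
  have hX1 : 1 ≤ X := by rw [hX]; linarith [(Nat.cast_nonneg ℓ : (0 : ℝ) ≤ ℓ)]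
  have hX0 : 0 < X := by linarith
  set C₁ := 1 + 32 ^ (9 / 8 : ℝ) * (M + (2 * k) ^ (-(3 / 2) : ℝ)) with hC₁
  have hC₁0 : 0 ≤ C₁ := by positivity
  have hC : decayConst k M = 2 * C₁ + 512 * M := rfl
  -- Up to distance `X ^ 3` the weight `(1 + ‖z‖) ^ (1/48)` costs at most `X ^ (1/16)`, the margin
  -- between the exponents `9/8` and `17/16`. Beyond it the large jump bound suffices.
  rcases le_or_gt ‖z‖ (X ^ 3) with hle | hgt
  · refine (mul_le_mul' le_rfl (h.le_rpow_level hk hM hz)).trans ?_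
    rw [← ENNReal.ofReal_mul (by positivity)]
    refine ENNReal.ofReal_le_ofReal ?_
    have h1 : (1 + ‖z‖) ^ (1 / 48 : ℝ) ≤ 2 * X ^ (1 / 16 : ℝ) := by
      have hX3 : 1 ≤ X ^ 3 := one_le_pow₀ hX1
      calc (1 + ‖z‖) ^ (1 / 48 : ℝ) ≤ (2 * X ^ 3) ^ (1 / 48 : ℝ) :=
            Real.rpow_le_rpow (by positivity) (by linarith) (by norm_num)
        _ = 2 ^ (1 / 48 : ℝ) * X ^ (1 / 16 : ℝ) := by
            rw [Real.mul_rpow (by norm_num) (by positivity), ← Real.rpow_natCast,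
              ← Real.rpow_mul hX0.le]
            norm_num
        _ ≤ 2 * X ^ (1 / 16 : ℝ) := by
            refine mul_le_mul_of_nonneg_right ?_ (by positivity)
            conv_rhs => rw [← Real.rpow_one 2]
            exact Real.rpow_le_rpow_of_exponent_le (by norm_num) (by norm_num)
    have h2 : X ^ (1 / 16 : ℝ) * X ^ (-(9 / 8) : ℝ) = X ^ (-(17 / 16) : ℝ) := by
      rw [← Real.rpow_add hX0]
      norm_num
    have h3 : 0 ≤ X ^ (-(17 / 16) : ℝ) := by positivity
    calc (1 + ‖z‖) ^ (1 / 48 : ℝ) * (C₁ * X ^ (-(9 / 8) : ℝ))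
        ≤ (2 * X ^ (1 / 16 : ℝ)) * (C₁ * X ^ (-(9 / 8) : ℝ)) :=
          mul_le_mul_of_nonneg_right h1 (by positivity)
      _ = 2 * C₁ * X ^ (-(17 / 16) : ℝ) := by rw [← h2]; ring
      _ ≤ decayConst k M * X ^ (-(17 / 16) : ℝ) := by
          rw [hC]
          exact mul_le_mul_of_nonneg_right (by linarith) h3
  · have hXX : X ≤ X ^ 3 := le_self_pow₀ hX1 (by norm_num)
    have hz1 : 1 ≤ ‖z‖ := by linarith
    refine (mul_le_mul' le_rfl (h.le_norm hM hz (by linarith))).trans ?_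
    rw [← ENNReal.ofReal_mul (by positivity)]
    refine ENNReal.ofReal_le_ofReal ?_
    have h1 : (1 + ‖z‖) ^ (1 / 48 : ℝ) ≤ 2 * ‖z‖ := by
      calc (1 + ‖z‖) ^ (1 / 48 : ℝ) ≤ (1 + ‖z‖) ^ (1 : ℝ) :=
            Real.rpow_le_rpow_of_exponent_le (by linarith) (by norm_num)
        _ ≤ 2 * ‖z‖ := by rw [Real.rpow_one]; linarith
    have h2 : X ^ 11 ≤ ‖z‖ ^ 7 := by
      calc X ^ 11 ≤ X ^ 21 := pow_le_pow_right₀ hX1 (by norm_num)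
        _ = (X ^ 3) ^ 7 := by ring
        _ ≤ ‖z‖ ^ 7 := pow_le_pow_left₀ (by positivity) hgt.le 7
    have h3 : X ^ 9 / ‖z‖ ^ 7 ≤ X ^ (-(17 / 16) : ℝ) := by
      calc X ^ 9 / ‖z‖ ^ 7 ≤ X ^ 9 / X ^ 11 :=
            div_le_div_of_nonneg_left (by positivity) (by positivity) h2
        _ = X ^ (-2 : ℝ) := by
            rw [Real.rpow_neg hX0.le, show (2 : ℝ) = ((2 : ℕ) : ℝ) by norm_num, Real.rpow_natCast]
            field_simp
        _ ≤ X ^ (-(17 / 16) : ℝ) := Real.rpow_le_rpow_of_exponent_le hX1 (by norm_num)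
    calc (1 + ‖z‖) ^ (1 / 48 : ℝ) * (X * (M * (2 * X / ‖z‖) ^ 8))
        ≤ (2 * ‖z‖) * (X * (M * (2 * X / ‖z‖) ^ 8)) :=
          mul_le_mul_of_nonneg_right h1 (by positivity)
      _ = 512 * M * (X ^ 9 / ‖z‖ ^ 7) := by field_simp; ring
      _ ≤ 512 * M * X ^ (-(17 / 16) : ℝ) := mul_le_mul_of_nonneg_left h3 (by positivity)
      _ ≤ decayConst k M * X ^ (-(17 / 16) : ℝ) := by
          rw [hC]
          exact mul_le_mul_of_nonneg_right (by linarith) (by positivity)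

end Green

/-! ### Expected number of close pairs -/

section Pairs

/-- Integration against the image of the weights `a` under `f`. -/
theorem tsum_fiber_mul {ι α : Type*} [DecidableEq α] (f : ι → α) (a : ι → ℝ≥0∞) (F : α → ℝ≥0∞) :
    ∑' z, (∑' i, if f i = z then a i else 0) * F z = ∑' i, a i * F (f i) := by
  calc ∑' z, (∑' i, if f i = z then a i else 0) * F z
      = ∑' z, ∑' i, if z = f i then a i * F (f i) else 0 := by
        refine tsum_congr fun z => ?_
        rw [← ENNReal.tsum_mul_right]
        refine tsum_congr fun i => ?_
        by_cases h : f i = z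
        · subst h; simp
        · simp [h, Ne.symm h]
    _ = ∑' i, a i * F (f i) := by
        rw [ENNReal.tsum_comm]
        exact tsum_congr fun i => tsum_ite_eq (f i) _

theorem LevelBounded.tsum_mul_le {d : ℕ} [NeZero d] {g : Site d → ℝ≥0∞}
    (hg : LevelBounded g 1) (φ : ℤ → ℝ≥0∞) : ∑' z : Site d, φ (z 0) * g z ≤ ∑' t, φ t := by
  calc ∑' z : Site d, φ (z 0) * g z = ∑' (z : Site d) (t : ℤ), φ t * (if z 0 = t then g z else 0) :=
        tsum_congr fun z => by simp
    _ = ∑' t : ℤ, φ t * ∑' z : Site d, (if z 0 = t then g z else 0) := by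
        rw [ENNReal.tsum_comm]
        exact tsum_congr fun t => ENNReal.tsum_mul_left
    _ ≤ ∑' t : ℤ, φ t * 1 := ENNReal.tsum_le_tsum fun t => mul_le_mul' le_rfl (hg t)
    _ = ∑' t, φ t := by simp

theorem tsum_ball {d : ℕ} (N : ℕ) (c : ℝ≥0∞) :
    ∑' y : Site d, (if ‖y‖ ≤ N then c else 0) = ((2 * N + 1) ^ d : ℕ) * c := by
  have hmem : ∀ y : Site d, ‖y‖ ≤ N ↔ y ∈ Finset.Icc (fun _ => -(N : ℤ)) (fun _ => (N : ℤ)) := by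
    intro y
    rw [pi_norm_le_iff_of_nonneg (Nat.cast_nonneg N), Finset.mem_Icc, Pi.le_def, Pi.le_def,
      ← forall_and]
    refine forall_congr' fun i => ?_
    rw [Int.norm_eq_abs, ← abs_le]
    exact_mod_cast Iff.rfl
  simp_rw [hmem]
  rw [tsum_eq_sum (s := Finset.Icc (fun _ => -(N : ℤ)) (fun _ => (N : ℤ))) fun y hy => if_neg hy,
    Finset.sum_ite_mem, Finset.inter_self, Finset.sum_const, Pi.card_Icc, nsmul_eq_mul]
  congr 2
  simp only [Int.card_Icc, Finset.prod_const, Finset.card_univ, Fintype.card_fin]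
  congr 1
  omega

/-- On each level `g` has mass at most one, so only the sum of `φ` over the levels matters. -/
theorem tsum_close_pairs_le {d : ℕ} [NeZero d] {g : Site d → ℝ≥0∞} (hg : LevelBounded g 1)
    (φ : ℤ → ℝ≥0∞) (V : Site d) (N : ℕ) :
    ∑' (z : Site d) (z' : Site d), (if ‖V + z - z'‖ ≤ N then φ (z 0) * g z' else 0) ≤
      ((2 * N + 1) ^ d : ℕ) * ∑' t, φ t := by
  calc ∑' (z : Site d) (z' : Site d), (if ‖V + z - z'‖ ≤ N then φ (z 0) * g z' else 0)
      = ∑' (z : Site d) (y : Site d), if ‖y‖ ≤ N then φ (z 0) * g (z + (V - y)) else 0 := by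
        refine tsum_congr fun z => ?_
        rw [← (Equiv.subLeft (V + z)).tsum_eq]
        refine tsum_congr fun y => ?_
        simp only [Equiv.subLeft_apply, sub_sub_cancel]
        rw [show V + z - y = z + (V - y) by abel]
    _ = ∑' y : Site d, if ‖y‖ ≤ N then ∑' z : Site d, φ (z 0) * g (z + (V - y)) else 0 := by
        rw [ENNReal.tsum_comm]
        refine tsum_congr fun y => ?_
        split_ifs <;> simp
    _ ≤ ∑' y : Site d, if ‖y‖ ≤ N then ∑' t, φ t else 0 := by
        refine ENNReal.tsum_le_tsum fun y => ?_
        split_ifs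
        · exact (hg.translate (V - y)).tsum_mul_le φ
        · exact le_rfl
    _ = _ := tsum_ball N _

/-- The summable profile that bounds the renewal function on the level `t`. -/
def profile (k M : ℝ) (t : ℤ) : ℝ≥0∞ :=
  if 0 ≤ t then ENNReal.ofReal (decayConst k M * (1 + (t : ℝ)) ^ (-(17 / 16) : ℝ)) else 0

theorem tsum_profile_ne_top (k M : ℝ) : ∑' t, profile k M t ≠ ∞ := by
  have h : ∑' t, profile k M t =
      ∑' n : ℕ, ENNReal.ofReal (decayConst k M * (1 + (n : ℝ)) ^ (-(17 / 16) : ℝ)) := by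
    rw [← Nat.cast_injective.tsum_eq (f := profile k M) (g := fun n : ℕ => (n : ℤ))]
    · exact tsum_congr fun n => by simp [profile]
    · intro t ht
      by_contra hne
      apply ht
      rw [profile, if_neg]
      intro h0
      obtain ⟨n, rfl⟩ := Int.eq_ofNat_of_zero_le h0
      exact hne ⟨n, rfl⟩
  rw [h]
  refine Summable.tsum_ofReal_ne_top (Summable.mul_left _ ?_)
  have := (summable_nat_add_iff 1).2 (Real.summable_nat_rpow.2 (show -(17 / 16 : ℝ) < -1 by norm_num))
  refine this.congr fun n => ?_
  push_cast
  rw [add_comm]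

variable {μ g : Site 4 → ℝ≥0∞} {k M : ℝ}

theorem IsRenewalPair.mul_le_profile (h : IsRenewalPair μ g k M) (hk : 0 < k) (hM : 0 ≤ M)
    (z : Site 4) :
    ENNReal.ofReal ((1 + ‖z‖) ^ (1 / 48 : ℝ)) * g z ≤ profile k M (z 0) := by
  by_cases hz : g z = 0
  · simp [hz]
  · have h0 := h.level_nonneg z hz
    obtain ⟨ℓ, hℓ⟩ := Int.eq_ofNat_of_zero_le h0
    rw [profile, if_pos h0, hℓ]
    exact h.decay hk hM hℓ

/-- The number of pairs of renewal points at distance at most `N`, for two independent renewal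
processes started `V` apart, is small when `V` is large: one of the two points is far from its
starting point. -/
theorem IsRenewalPair.tsum_pairs_le (h : IsRenewalPair μ g k M) (hk : 0 < k) (hM : 0 ≤ M)
    (V : Site 4) {N : ℕ} (hN : 0 < N) :
    ENNReal.ofReal (‖V‖ ^ (1 / 48 : ℝ)) *
      ∑' (z : Site 4) (z' : Site 4), (if ‖V + z - z'‖ ≤ N then g z * g z' else 0) ≤
      162 * (N : ℝ≥0∞) ^ 5 * ∑' t, profile k M t := by
  set Φ := ∑' t, profile k M t with hΦ
  have hN1 : (1 : ℝ) ≤ N := by exact_mod_cast hN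
  have hpt : ∀ z z' : Site 4, ENNReal.ofReal (‖V‖ ^ (1 / 48 : ℝ)) *
      (if ‖V + z - z'‖ ≤ N then g z * g z' else 0) ≤
      N * (if ‖V + z - z'‖ ≤ N then profile k M (z 0) * g z' else 0) +
        (if ‖-V + z' - z‖ ≤ N then profile k M (z' 0) * g z else 0) := fun z z' => by
    have hsymm : ‖-V + z' - z‖ = ‖V + z - z'‖ := by
      rw [← norm_neg]
      congr 1
      abel
    rw [hsymm]
    split_ifs with hc
    · have hV : ‖V‖ ^ (1 / 48 : ℝ) ≤
          N * (1 + ‖z‖) ^ (1 / 48 : ℝ) + (1 + ‖z'‖) ^ (1 / 48 : ℝ) := by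
        have h1 : ‖V‖ ≤ N * (1 + ‖z‖) + (1 + ‖z'‖) := by
          have e : V = (V + z - z') - z + z' := by abel
          have h2 : ‖V‖ ≤ ‖V + z - z'‖ + ‖z‖ + ‖z'‖ := by
            conv_lhs => rw [e]
            exact (norm_add_le _ _).trans (add_le_add (norm_sub_le _ _) le_rfl)
          nlinarith [norm_nonneg z]
        calc ‖V‖ ^ (1 / 48 : ℝ) ≤ (N * (1 + ‖z‖) + (1 + ‖z'‖)) ^ (1 / 48 : ℝ) :=
              Real.rpow_le_rpow (norm_nonneg _) h1 (by norm_num)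
          _ ≤ (N * (1 + ‖z‖)) ^ (1 / 48 : ℝ) + (1 + ‖z'‖) ^ (1 / 48 : ℝ) :=
              Real.rpow_add_le_add_rpow (by positivity) (by positivity) (by norm_num) (by norm_num)
          _ ≤ _ := by
              rw [Real.mul_rpow (by positivity) (by positivity)]
              gcongr
              conv_rhs => rw [← Real.rpow_one (N : ℝ)]
              exact Real.rpow_le_rpow_of_exponent_le hN1 (by norm_num)
      calc ENNReal.ofReal (‖V‖ ^ (1 / 48 : ℝ)) * (g z * g z')
          ≤ (N * ENNReal.ofReal ((1 + ‖z‖) ^ (1 / 48 : ℝ)) +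
              ENNReal.ofReal ((1 + ‖z'‖) ^ (1 / 48 : ℝ))) * (g z * g z') := by
            refine mul_le_mul' ((ENNReal.ofReal_le_ofReal hV).trans_eq ?_) le_rfl
            rw [ENNReal.ofReal_add (by positivity) (by positivity),
              ENNReal.ofReal_mul (by positivity), ENNReal.ofReal_natCast]
        _ = N * ((ENNReal.ofReal ((1 + ‖z‖) ^ (1 / 48 : ℝ)) * g z) * g z') +
              (ENNReal.ofReal ((1 + ‖z'‖) ^ (1 / 48 : ℝ)) * g z') * g z := by ring
        _ ≤ _ := by
            gcongr
            · exact h.mul_le_profile hk hM z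
            · exact h.mul_le_profile hk hM z'
    · simp
  have hsum : ((2 * N + 1) ^ 4 : ℕ) * (N + 1 : ℝ≥0∞) ≤ 162 * (N : ℝ≥0∞) ^ 5 := by
    have : (2 * N + 1) ^ 4 * (N + 1) ≤ 162 * N ^ 5 := by
      calc (2 * N + 1) ^ 4 * (N + 1) ≤ (3 * N) ^ 4 * (2 * N) :=
            Nat.mul_le_mul (Nat.pow_le_pow_left (by omega) 4) (by omega)
        _ = 162 * N ^ 5 := by ring
    exact_mod_cast this
  calc ENNReal.ofReal (‖V‖ ^ (1 / 48 : ℝ)) *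
        ∑' (z : Site 4) (z' : Site 4), (if ‖V + z - z'‖ ≤ N then g z * g z' else 0)
      ≤ ∑' (z : Site 4) (z' : Site 4),
          (N * (if ‖V + z - z'‖ ≤ N then profile k M (z 0) * g z' else 0) +
          (if ‖-V + z' - z‖ ≤ N then profile k M (z' 0) * g z else 0)) := by
        simp_rw [← ENNReal.tsum_mul_left]
        exact ENNReal.tsum_le_tsum fun z => ENNReal.tsum_le_tsum fun z' => hpt z z'
    _ = N * (∑' (z : Site 4) (z' : Site 4),
          (if ‖V + z - z'‖ ≤ N then profile k M (z 0) * g z' else 0)) +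
        ∑' (z' : Site 4) (z : Site 4),
          (if ‖-V + z' - z‖ ≤ N then profile k M (z' 0) * g z else 0) := by
        simp_rw [ENNReal.tsum_add, ENNReal.tsum_mul_left]
        congr 1
        exact ENNReal.tsum_comm
    _ ≤ N * (((2 * N + 1) ^ 4 : ℕ) * Φ) + ((2 * N + 1) ^ 4 : ℕ) * Φ := by
        gcongr
        · exact tsum_close_pairs_le h.levelBounded _ V N
        · exact tsum_close_pairs_le h.levelBounded _ (-V) N
    _ = (((2 * N + 1) ^ 4 : ℕ) * (N + 1 : ℝ≥0∞)) * Φ := by ring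
    _ ≤ _ := mul_le_mul' hsum le_rfl

end Pairs

/-! ### The renewal pair of the conditioned walk -/

section Assembly

/-- The law of the displacement of a block. -/
def blockLaw {d : ℕ} [NeZero d] (Q : Measure (SiteLaw d)) (z : Site d) : ℝ≥0∞ :=
  ∑' b : Block d, if disp b.1 = z then wordWeight Q b.1 else 0

/-- The probability that the conditioned walk regenerates at `z`. -/
def renewalFun {d : ℕ} [NeZero d] (Q : Measure (SiteLaw d)) (z : Site d) : ℝ≥0∞ :=
  ∑' l : RecordWord d, if disp l.1 = z then wordWeight Q l.1 else 0

theorem tsum_block_length_pow_le {d : ℕ} [NeZero d] {Q : Measure (SiteLaw d)}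
    [IsProbabilityMeasure Q] {M : ℝ≥0} {r : ℝ} (hT : ∀ᵐ Y ∂annealedLaw Q 0, Transient Y)
    (hM : regenerationMoment Q r ≤ M) {m : ℕ} (hm : m ≤ r) :
    ∑' b : Block d, wordWeight Q b.1 * (b.1.length : ℝ≥0∞) ^ m ≤ M := by
  refine le_trans (ENNReal.tsum_le_tsum fun b => mul_le_mul' le_rfl ?_)
    ((tsum_block_length_rpow_le hT r).trans hM)
  rw [← ENNReal.rpow_natCast]
  refine ENNReal.rpow_le_rpow_of_exponent_le ?_ hm
  exact_mod_cast List.length_pos_iff.2 b.2.ne_nil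

variable {Q : Measure (SiteLaw 4)} [IsProbabilityMeasure Q]

theorem isRenewalPair {κ r : ℝ} {M : ℝ≥0} (hQ : UniformlyElliptic Q κ) (hr : 8 < r)
    (hT : ∀ᵐ Y ∂annealedLaw Q 0, Transient Y) (hM : regenerationMoment Q r ≤ M) :
    IsRenewalPair (blockLaw Q) (renewalFun Q) (κ ^ 4) M where
  mass_le := by
    have := tsum_fiber_mul (fun b : Block 4 => disp b.1) (fun b => wordWeight Q b.1) fun _ => 1
    simp only [mul_one] at this
    exact (this.trans (tsum_block hT)).le
  level_pos y hy := by
    rw [blockLaw, Ne, ENNReal.tsum_eq_zero.not] at hy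
    push Not at hy
    obtain ⟨b, hb⟩ := hy
    split_ifs at hb with h
    · rw [← h]
      exact b.2.below.disp_pos b.2.ne_nil
    · exact absurd rfl hb
  le_elementary s hs := by
    have h0 : ∀ s ∈ ({1, 2, 3} : Finset (Fin 4)).powerset, (0 : Fin 4) ∉ s := by decide
    have h1 := ENNReal.le_tsum (f := fun b : Block 4 =>
      if disp b.1 = elementaryDisp s then wordWeight Q b.1 else 0)
      ⟨elementaryWord s, isBlock_elementaryWord (h0 s hs)⟩
    rw [if_pos (disp_elementaryWord s)] at h1
    rw [ENNReal.ofReal_pow hQ.1.le]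
    exact (pow_le_wordWeight_elementaryWord hQ hQ.le_one (h0 s hs)).trans h1
  tail_le a ha := by
    have ha' : (0 : ℝ) < (a : ℝ) ^ 8 := by positivity
    have h1 : ∑' y, (if (a : ℝ) ≤ ‖y‖ then blockLaw Q y else 0) =
        ∑' b : Block 4, wordWeight Q b.1 * (if (a : ℝ) ≤ ‖disp b.1‖ then 1 else 0) := by
      rw [← tsum_fiber_mul (fun b : Block 4 => disp b.1) (fun b => wordWeight Q b.1)
        fun z => if (a : ℝ) ≤ ‖z‖ then 1 else 0]
      exact tsum_congr fun y => by simp [blockLaw]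
    rw [h1, ENNReal.ofReal_div_of_pos ha',
      ENNReal.le_div_iff_mul_le (Or.inl (by simpa using ha.ne')) (Or.inl ENNReal.ofReal_ne_top),
      ENNReal.ofReal_coe_nnreal, ← ENNReal.tsum_mul_right]
    refine le_trans (ENNReal.tsum_le_tsum fun b => ?_)
      (tsum_block_length_pow_le hT hM (m := 8) (by exact_mod_cast hr.le))
    rw [mul_assoc]
    refine mul_le_mul' le_rfl ?_
    split_ifs with h
    · have h2 : a ≤ b.1.length := by exact_mod_cast h.trans (norm_disp_le b.1)
      rw [one_mul, ENNReal.ofReal_pow (Nat.cast_nonneg a), ENNReal.ofReal_natCast]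
      gcongr
    · simp
  renewal_le z := by
    refine (tsum_recordWord_le fun l => if disp l = z then wordWeight Q l else 0).trans ?_
    refine add_le_add ?_ ?_
    · simp [wordWeight_nil, eq_comm]
    · refine le_of_eq ?_
      rw [convOp_apply]
      unfold blockLaw
      rw [tsum_fiber_mul (fun b : Block 4 => disp b.1) (fun b => wordWeight Q b.1)
        fun y => renewalFun Q (z - y)]
      refine tsum_congr fun b => ?_
      rw [renewalFun, ← ENNReal.tsum_mul_left]
      refine tsum_congr fun l => ?_
      simp only [disp_append, wordWeight_append Q b.2.below l.2.above, mul_ite, mul_zero]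
      exact if_congr (by rw [eq_sub_iff_add_eq, add_comm]) rfl rfl
  levelBounded ℓ := by
    refine le_of_eq_of_le ?_ (levelWeight_le_one (noBacktrackProb_ne_zero hT) ℓ)
    have := tsum_fiber_mul (fun l : RecordWord 4 => disp l.1) (fun l => wordWeight Q l.1)
      fun z => if z 0 = ℓ then 1 else 0
    simp only [mul_ite, mul_one, mul_zero] at this
    exact this
  level_nonneg y hy := by
    rw [renewalFun, Ne, ENNReal.tsum_eq_zero.not] at hy
    push Not at hy
    obtain ⟨l, hl⟩ := hy
    split_ifs at hl with h
    · rw [← h]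
      exact l.2.above.disp_nonneg
    · exact absurd rfl hl

theorem conditionedPairLaw_intersect_mul_le {κ r : ℝ} {M : ℝ≥0} (hQ : UniformlyElliptic Q κ)
    (hr : 8 < r) (hT : ∀ᵐ Y ∂annealedLaw Q 0, Transient Y) (hM : regenerationMoment Q r ≤ M)
    (U₁ U₂ : Site 4) :
    ENNReal.ofReal (‖U₁ - U₂‖ ^ (1 / 48 : ℝ)) * conditionedPairLaw Q U₁ U₂ (intersect 4) ≤
      5184 * (∑' t, profile (κ ^ 4) M t) * M := by
  set Φ := ∑' t, profile (κ ^ 4) M t with hΦ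
  set V := U₁ - U₂ with hV
  set w : Block 4 → ℝ≥0∞ := fun b => wordWeight Q b.1 with hw
  have hpair := isRenewalPair hQ hr hT hM
  have hq : ∑' b, w b = 1 := tsum_block hT
  have hm : ∑' b, w b * (b.1.length : ℝ≥0∞) ^ 5 ≤ M :=
    tsum_block_length_pow_le hT hM (m := 5) (by push_cast; linarith)
  have hfiber : ∀ (b b' : Block 4),
      ∑' (l : RecordWord 4) (l' : RecordWord 4),
        (if ‖V + disp l.1 - disp l'.1‖ ≤ (b.1.length + b'.1.length : ℕ) then
          (wordWeight Q l.1 * w b) * (wordWeight Q l'.1 * w b') else 0) =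
      w b * w b' * ∑' (z : Site 4) (z' : Site 4),
        (if ‖V + z - z'‖ ≤ (b.1.length + b'.1.length : ℕ) then
          renewalFun Q z * renewalFun Q z' else 0) := fun b b' => by
    set N := b.1.length + b'.1.length
    have h1 : ∀ z : Site 4, ∑' z' : Site 4, (if ‖V + z - z'‖ ≤ N then
          renewalFun Q z * renewalFun Q z' else 0) = renewalFun Q z *
          ∑' l' : RecordWord 4, wordWeight Q l'.1 * (if ‖V + z - disp l'.1‖ ≤ N then 1 else 0) :=
      fun z => by
        rw [← tsum_fiber_mul (fun l : RecordWord 4 => disp l.1) (fun l => wordWeight Q l.1)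
          fun z' => if ‖V + z - z'‖ ≤ N then 1 else 0, ← ENNReal.tsum_mul_left]
        exact tsum_congr fun z' => by simp [renewalFun]
    simp_rw [h1]
    unfold renewalFun
    rw [tsum_fiber_mul (fun l : RecordWord 4 => disp l.1) (fun l => wordWeight Q l.1)
      fun z => ∑' l' : RecordWord 4, wordWeight Q l'.1 *
        (if ‖V + z - disp l'.1‖ ≤ N then 1 else 0)]
    simp_rw [← ENNReal.tsum_mul_left]
    refine tsum_congr fun l => tsum_congr fun l' => ?_
    split_ifs
    · ring
    · simp
  have hlen : ∀ b b' : Block 4, ((b.1.length + b'.1.length : ℕ) : ℝ≥0∞) ^ 5 ≤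
      16 * ((b.1.length : ℝ≥0∞) ^ 5 + (b'.1.length : ℝ≥0∞) ^ 5) := fun b b' => by
    have := add_pow_le (Nat.zero_le b.1.length) (Nat.zero_le b'.1.length) 5
    exact_mod_cast this
  calc ENNReal.ofReal (‖V‖ ^ (1 / 48 : ℝ)) * conditionedPairLaw Q U₁ U₂ (intersect 4)
      ≤ ENNReal.ofReal (‖V‖ ^ (1 / 48 : ℝ)) * ∑' (b : Block 4) (b' : Block 4),
          w b * w b' * ∑' (z : Site 4) (z' : Site 4),
          (if ‖V + z - z'‖ ≤ (b.1.length + b'.1.length : ℕ) then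
            renewalFun Q z * renewalFun Q z' else 0) := by
        refine mul_le_mul' le_rfl ((conditionedPairLaw_intersect_le hT U₁ U₂).trans_eq ?_)
        exact tsum_congr fun b => tsum_congr fun b' => hfiber b b'
    _ ≤ ∑' (b : Block 4) (b' : Block 4), 2592 * Φ * (w b * w b' *
          ((b.1.length : ℝ≥0∞) ^ 5 + (b'.1.length : ℝ≥0∞) ^ 5)) := by
        simp_rw [← ENNReal.tsum_mul_left (a := ENNReal.ofReal _)]
        refine ENNReal.tsum_le_tsum fun b => ENNReal.tsum_le_tsum fun b' => ?_
        have hN : 0 < b.1.length + b'.1.length :=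
          Nat.add_pos_left (List.length_pos_iff.2 b.2.ne_nil) _
        have h1 := hpair.tsum_pairs_le (pow_pos hQ.1 4) M.2 V hN
        rw [mul_left_comm]
        refine (mul_le_mul' le_rfl (h1.trans (mul_le_mul' (mul_le_mul' le_rfl (hlen b b'))
          le_rfl))).trans_eq ?_
        ring
    _ = 2592 * Φ * (2 * ∑' b, w b * (b.1.length : ℝ≥0∞) ^ 5) := by
        simp_rw [ENNReal.tsum_mul_left]
        congr 1
        have h1 : ∀ b b' : Block 4, w b * w b' *
            ((b.1.length : ℝ≥0∞) ^ 5 + (b'.1.length : ℝ≥0∞) ^ 5) =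
            (w b * (b.1.length : ℝ≥0∞) ^ 5) * w b' +
              w b * (w b' * (b'.1.length : ℝ≥0∞) ^ 5) := fun b b' => by ring
        simp_rw [h1, ENNReal.tsum_add, ENNReal.tsum_mul_left, ENNReal.tsum_mul_right, hq]
        ring
    _ ≤ 2592 * Φ * (2 * M) := by gcongr
    _ = 5184 * Φ * M := by ring

end Assembly

end RWRE

end

theorem mainTheorem5 (r : ℝ) (hr : 8 < r) :
    ∃ K : ℝ, 0 < K ∧ ∀ (κ : ℝ) (M : ℝ≥0), ∃ C : ℝ, 0 < C ∧
      ∀ (Q : Measure (RWRE.SiteLaw 4)) [IsProbabilityMeasure Q]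
        (v : EuclideanSpace ℝ (Fin 4)) (S : Matrix (Fin 4) (Fin 4) ℝ) (ε : ℝ),
        RWRE.UniformlyElliptic Q κ →
        RWRE.LawOfLargeNumbers Q v → 0 < v 0 →
        RWRE.AnnealedInvariancePrinciple Q v S →
        0 < ε → RWRE.firstRegenerationMoment Q ε < ∞ →
        RWRE.regenerationMoment Q r ≤ M →
        ∀ U₁ U₂ : RWRE.Site 4, U₁ ≠ U₂ →
          (RWRE.conditionedPairLaw Q U₁ U₂).real (RWRE.intersect 4)
            < C * ‖U₁ - U₂‖ ^ (-K) := by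
  refine ⟨1 / 48, by norm_num, fun κ M => ?_⟩
  set C : ℝ≥0∞ := 5184 * (∑' t, RWRE.profile (κ ^ 4) M t) * M with hC
  have hCtop : C ≠ ∞ := ENNReal.mul_ne_top
    (ENNReal.mul_ne_top (by norm_num) (RWRE.tsum_profile_ne_top _ _)) ENNReal.coe_ne_top
  refine ⟨C.toReal + 1, by positivity, fun Q _ v S ε hQ hL hv _ _ _ hM U₁ U₂ hU => ?_⟩
  have hpos : 0 < ‖U₁ - U₂‖ ^ (1 / 48 : ℝ) :=
    Real.rpow_pos_of_pos (norm_pos_iff.2 (sub_ne_zero.2 hU)) _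
  have h := ENNReal.toReal_mono hCtop
    (RWRE.conditionedPairLaw_intersect_mul_le hQ hr (hL.transient hv) hM U₁ U₂)
  rw [ENNReal.toReal_mul, ENNReal.toReal_ofReal hpos.le] at h
  rw [Real.rpow_neg (norm_nonneg _), ← div_eq_mul_inv, lt_div_iff₀ hpos, mul_comm]
  exact h.trans_lt (lt_add_one _)
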